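/- Let $I$ be a non-empty set with a Cartan datum, i.e. a symmetric bilinear form $\cdot:\mathbb{Z}I\otimes\mathbb{Z}I\to\mathbb{Z}$ with $i\cdot i\in 2\mathbb{Z}_{>0}$ for all $i$ and $2\frac{i\cdot j}{i\cdot i}\in\mathbb{Z}_{\leqslant 0}$ for all $i\neq j$. Let a root datum of this type be given: finitely generated free abelian groups $X$, $Y$, a perfect pairing $\langle\cdot,\cdot\rangle:Y\otimes X\to\mathbb{Z}$, and injective maps $I\to X$, $i\mapsto i$, and $I\to Y$, $i\mapsto i^\vee$, with $\langle i^\vee,j\rangle=2\frac{i\cdot j}{i\cdot i}$. Put $c_{i,j}=\langle i^\vee,j\rangle$, $d_i=\frac{i\cdot i}{2}$, $q_i=q^{d_i}$, $[k]_i=\frac{q_i^k-q_i^{-k}}{q_i-q_i^{-1}}$, $[n]_i!=\prod_{l=1}^n[l]_i$, and write $x^{(n)}=x^n/[n]_i!$. Let $U$ be the unital $\mathbb{Q}(q)$-algebra generated by $e_i,f_i$ ($i\in I$) and $k_\mu$ ($\mu\in Y$), with $k_i=k_{d_ii^\vee}$, subject to: $k_0=1$, $k_\mu k_{\mu'}=k_{\mu+\mu'}$;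 $k_\mu e_i=q^{\langle\mu,i\rangle}e_ik_\mu$, $k_\mu f_i=q^{-\langle\mu,i\rangle}f_ik_\mu$; $e_if_j-f_je_i=\delta_{i,j}\frac{k_i-k_i^{-1}}{q_i-q_i^{-1}}$; and, for $i\neq j$, the quantum Serre relations $\sum_{\ell=0}^{1-c_{i,j}}(-1)^\ell e_i^{(\ell)}e_je_i^{(1-c_{i,j}-\ell)}=0$ and $\sum_{\ell=0}^{1-c_{i,j}}(-1)^\ell f_i^{(\ell)}f_jf_i^{(1-c_{i,j}-\ell)}=0$. It has the coproduct $\Delta(e_i)=e_i\otimes1+k_i\otimes e_i$, $\Delta(f_i)=f_i\otimes k_i^{-1}+1\otimes f_i$, $\Delta(k_\mu)=k_\mu\otimes k_\mu$ and the antipode $S(e_i)=-k_i^{-1}e_i$, $S(f_i)=-f_ik_i$, $S(k_\mu)=k_{\mu}^{-1}$, and $U$ acts on itself by the left adjoint action $\mathrm{ad}_z(y)=\sum z_{(1)}\,y\,S(z_{(2)})$, where $\Delta(z)=\sum z_{(1)}\otimes z_{(2)}$. Fix $i\in I$. Let $U_i$ be the subalgebra of $U$ generated by $e_i,f_i,k_i$,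 let $U^+$ be the subalgebra generated by all $e_j$, $j\in I$, and let $U^+[i]$ be the subalgebra generated by the elements $\mathrm{ad}_{e_i}^{(n)}(e_j)=\frac{1}{[n]_i!}\mathrm{ad}_{e_i}^n(e_j)$ for $j\in I\setminus\{i\}$ and $n\geqslant0$. A representation $V$ of $U_i$ is called integrable if $V=\bigoplus_{n\in\mathbb{Z}}V_n$ with $V_n=\{v\in V: k_iv=q_i^nv\}$, and for every $v\in V$ there is $n\geqslant 0$ with $e_i^nv=f_i^nv=0$. Then $U^+[i]\subseteq U^+$, the subalgebra $U^+[i]$ is stable under the adjoint action of $U_i$, and the adjoint action of $U_i$ on $U^+[i]$ is an integrable representation. Furthermore, $U^+[i]$ is maximal in the following sense: if $V\subseteq U^+$ is a $U_i$-submodule of $U$ for the adjoint action which is integrable, then $V\subseteq U^+[i]$. -/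

import Mathlib

open scoped TensorProduct

namespace QuantumAdjoint

/-! ### Cartan data and root data -/

/-- A Cartan datum: the values on basis elements of a symmetric bilinear form on `ℤI` such that
`i · i` is a positive even integer and `2 (i · j) / (i · i)` is a nonpositive integer for `i ≠ j`. -/
structure CartanDatum (I : Type*) where
  dot : I → I → ℤ
  dot_comm : ∀ i j, dot i j = dot j i
  dot_self_pos : ∀ i, 0 < dot i i
  dot_self_even : ∀ i, Even (dot i i)
  dot_self_dvd : ∀ i j, i ≠ j → dot i i ∣ 2 * dot i j
  dot_nonpos : ∀ i j, i ≠ j → 2 * dot i j / dot i i ≤ 0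

/-- The integer `d_i = (i · i) / 2`. -/
def CartanDatum.d {I : Type*} (C : CartanDatum I) (i : I) : ℤ := C.dot i i / 2

/-- A root datum of type `C`: finitely generated free abelian groups `X` (weights) and
`Y` (dual weights) with a perfect pairing, and injective families of simple roots and simple coroots
with `⟨i^∨, j⟩ = 2 (i · j) / (i · i)`. -/
structure RootDatum {I : Type*} (C : CartanDatum I) (X Y : Type*)
    [AddCommGroup X] [AddCommGroup Y] where
  free_X : Module.Free ℤ X
  finite_X : Module.Finite ℤ X
  free_Y : Module.Free ℤ Y
  finite_Y : Module.Finite ℤ Y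
  pairing : Y →ₗ[ℤ] X →ₗ[ℤ] ℤ
  perfect : pairing.IsPerfPair
  root : I → X
  coroot : I → Y
  root_injective : Function.Injective root
  coroot_injective : Function.Injective coroot
  pairing_coroot_root : ∀ i j,
    C.dot i i * pairing (coroot i) (root j) = 2 * C.dot i j

/-! ### Quantum integers and divided powers -/

/-- The field `ℚ(q)`. -/
abbrev K : Type := RatFunc ℚ

/-- The indeterminate `q`. -/
noncomputable def q : K := RatFunc.X

/-- The quantum integer `(v ^ k - v ^ (-k)) / (v - v⁻¹)`. -/
noncomputable def qInt (v : K) (k : ℤ) : K := (v ^ k - v ^ (-k)) / (v - v⁻¹)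

/-- The quantum factorial `[n]! = [1] [2] ⋯ [n]`. -/
noncomputable def qFact (v : K) (n : ℕ) : K := ∏ l ∈ Finset.range n, qInt v ((l : ℤ) + 1)

section Algebra

variable {A : Type*} [Ring A] [Algebra K A]

/-- The divided power `x ^ (n) = x ^ n / [n]!`. -/
noncomputable def divPow (v : K) (n : ℕ) (x : A) : A := (qFact v n)⁻¹ • x ^ n

/-- The quantum Serre expression `∑_{l = 0}^{m} (-1)^l x^(l) y x^(m - l)`. -/
noncomputable def serre (v : K) (m : ℕ) (x y : A) : A :=
  ∑ l ∈ Finset.range (m + 1), (-1 : K) ^ l • (divPow v l x * y * divPow v (m - l) x)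

end Algebra

/-! ### The quantum group -/

variable {I X Y : Type*} [AddCommGroup X] [AddCommGroup Y] {C : CartanDatum I}

/-- The generators `e_i`, `f_i` and `k_μ`. -/
inductive Gen (I Y : Type*)
  | e (i : I) : Gen I Y
  | f (i : I) : Gen I Y
  | k (μ : Y) : Gen I Y

/-- `q_i = q ^ d_i`. -/
noncomputable def CartanDatum.q (C : CartanDatum I) (i : I) : K := QuantumAdjoint.q ^ C.d i

namespace RootDatum

/-- `c_{i,j} = ⟨i^∨, j⟩`. -/
def c (D : RootDatum C X Y) (i j : I) : ℤ := D.pairing (D.coroot i) (D.root j)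

/-- The element `d_i i^∨` of `Y`, so that `k_i = k_{d_i i^∨}`. -/
def h (D : RootDatum C X Y) (i : I) : Y := C.d i • D.coroot i

/-- The defining relations of the quantum group. -/
inductive Rel (D : RootDatum C X Y) :
    FreeAlgebra K (Gen I Y) → FreeAlgebra K (Gen I Y) → Prop
  | k_zero : Rel D (FreeAlgebra.ι K (.k 0)) 1
  | k_add (μ ν : Y) : Rel D (FreeAlgebra.ι K (.k μ) * FreeAlgebra.ι K (.k ν))
      (FreeAlgebra.ι K (.k (μ + ν)))
  | k_e (μ : Y) (i : I) : Rel D (FreeAlgebra.ι K (.k μ) * FreeAlgebra.ι K (.e i))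
      (q ^ D.pairing μ (D.root i) • (FreeAlgebra.ι K (.e i) * FreeAlgebra.ι K (.k μ)))
  | k_f (μ : Y) (i : I) : Rel D (FreeAlgebra.ι K (.k μ) * FreeAlgebra.ι K (.f i))
      (q ^ (-D.pairing μ (D.root i)) • (FreeAlgebra.ι K (.f i) * FreeAlgebra.ι K (.k μ)))
  | e_f_same (i : I) : Rel D
      (FreeAlgebra.ι K (.e i) * FreeAlgebra.ι K (.f i)
        - FreeAlgebra.ι K (.f i) * FreeAlgebra.ι K (.e i))
      ((C.q i - (C.q i)⁻¹)⁻¹ •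
        (FreeAlgebra.ι K (.k (D.h i)) - FreeAlgebra.ι K (.k (-D.h i))))
  | e_f_ne (i j : I) (hij : i ≠ j) : Rel D
      (FreeAlgebra.ι K (.e i) * FreeAlgebra.ι K (.f j)
        - FreeAlgebra.ι K (.f j) * FreeAlgebra.ι K (.e i)) 0
  | serre_e (i j : I) (hij : i ≠ j) : Rel D
      (serre (C.q i) (1 - D.c i j).toNat (FreeAlgebra.ι K (.e i)) (FreeAlgebra.ι K (.e j))) 0
  | serre_f (i j : I) (hij : i ≠ j) : Rel D
      (serre (C.q i) (1 - D.c i j).toNat (FreeAlgebra.ι K (.f i)) (FreeAlgebra.ι K (.f j))) 0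

/-- The quantum group `U` over `ℚ(q)` attached to the root datum `D`. -/
def U (D : RootDatum C X Y) : Type _ := RingQuot (Rel D)

noncomputable instance (D : RootDatum C X Y) : Ring D.U := inferInstanceAs (Ring (RingQuot (Rel D)))

noncomputable instance (D : RootDatum C X Y) : Algebra K D.U :=
  inferInstanceAs (Algebra K (RingQuot (Rel D)))

/-- The projection from the free algebra. -/
noncomputable def proj (D : RootDatum C X Y) : FreeAlgebra K (Gen I Y) →ₐ[K] D.U :=
  RingQuot.mkAlgHom K (Rel D)

noncomputable def e (D : RootDatum C X Y) (i : I) : D.U := D.proj (FreeAlgebra.ι K (.e i))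

noncomputable def f (D : RootDatum C X Y) (i : I) : D.U := D.proj (FreeAlgebra.ι K (.f i))

noncomputable def k (D : RootDatum C X Y) (μ : Y) : D.U := D.proj (FreeAlgebra.ι K (.k μ))

end RootDatum

/-! ### Auxiliary facts: the quantum Serre expression as an iterated `q`-commutator -/

lemma q_ne_zero : q ≠ 0 := RatFunc.X_ne_zero

lemma q_zpow_ne_one {n : ℤ} (hn : 0 < n) : q ^ n ≠ 1 := by
  obtain ⟨m, rfl⟩ := Int.eq_ofNat_of_zero_le hn.le
  have hm : m ≠ 0 := by rintro rfl; simp at hn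
  intro h
  have h1 : (algebraMap (Polynomial ℚ) K) (Polynomial.X ^ m) = algebraMap (Polynomial ℚ) K 1 := by
    rw [map_pow, RatFunc.algebraMap_X, map_one]
    rw [← h]
    exact (zpow_natCast _ _).symm
  have h2 := RatFunc.algebraMap_injective ℚ h1
  have h3 := congrArg Polynomial.natDegree h2
  simp at h3
  exact hm h3

section Aux

lemma qInt_ne_zero {v : K} (hv : v ≠ 0) (h : ∀ n : ℤ, 0 < n → v ^ n ≠ 1) (n : ℕ) :
    qInt v ((n : ℤ) + 1) ≠ 0 := by
  have key : ∀ k : ℤ, 0 < k → v ^ k - v ^ (-k) ≠ 0 := by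
    intro k hk h0
    apply h (k + k) (by omega)
    rw [zpow_add₀ hv]
    nth_rewrite 1 [sub_eq_zero.1 h0]
    rw [← zpow_add₀ hv]; simp
  have h1 := key 1 one_pos
  rw [zpow_one, zpow_neg_one] at h1
  exact div_ne_zero (key _ (by omega)) h1

lemma qFact_succ (v : K) (n : ℕ) : qFact v (n + 1) = qFact v n * qInt v ((n : ℤ) + 1) :=
  Finset.prod_range_succ _ _

lemma qFact_ne_zero {v : K} (hv : v ≠ 0) (h : ∀ n : ℤ, 0 < n → v ^ n ≠ 1) (n : ℕ) :
    qFact v n ≠ 0 :=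
  Finset.prod_ne_zero_iff.2 fun l _ => qInt_ne_zero hv h l

lemma qInt_inv (v : K) (n : ℤ) : qInt v⁻¹ n = qInt v n := by
  simp only [qInt, inv_zpow', neg_neg, inv_inv]
  rw [← neg_sub, ← neg_sub v, neg_div_neg_eq]

lemma qFact_inv (v : K) (n : ℕ) : qFact v⁻¹ n = qFact v n := by
  simp only [qFact, qInt_inv]

variable {A : Type*} [Ring A] [Algebra K A] {B : Type*} [Ring B] [Algebra K B]

lemma map_serre (φ : A →ₐ[K] B) (v : K) (m : ℕ) (x y : A) :
    φ (serre v m x y) = serre v m (φ x) (φ y) := by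
  simp [serre, divPow]

lemma serre_inv (v : K) (m : ℕ) (x y : A) : serre v⁻¹ m x y = serre v m x y := by
  simp only [serre, divPow, qFact_inv]

lemma serre_add (v : K) (m : ℕ) (x y y' : A) :
    serre v m x (y + y') = serre v m x y + serre v m x y' := by
  simp only [serre, mul_add, add_mul, smul_add, Finset.sum_add_distrib]

lemma serre_eq_antidiagonal (v : K) (m : ℕ) (x y : A) :
    serre v m x y = ∑ p ∈ Finset.HasAntidiagonal.antidiagonal m,
      (-1 : K) ^ p.1 • (divPow v p.1 x * y * divPow v p.2 x) :=
  (Finset.Nat.sum_antidiagonal_eq_sum_range_succ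
    (fun a b => (-1 : K) ^ a • (divPow v a x * y * divPow v b x)) m).symm

lemma serre_op (v : K) (m : ℕ) (x y : A) :
    serre v m (MulOpposite.op x) (MulOpposite.op y)
      = (-1 : K) ^ m • MulOpposite.op (serre v m x y) := by
  have h : ∀ n, divPow v n (MulOpposite.op x) = MulOpposite.op (divPow v n x) := by
    intro n; simp [divPow]
  rw [serre_eq_antidiagonal, serre_eq_antidiagonal, ← MulOpposite.op_smul, Finset.smul_sum,
    ← Finset.Nat.sum_antidiagonal_swap (n := m), Finset.op_sum]
  refine Finset.sum_congr rfl fun p hp => ?_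
  rw [Finset.HasAntidiagonal.mem_antidiagonal] at hp
  rw [h, h, ← MulOpposite.op_mul, ← MulOpposite.op_mul, ← MulOpposite.op_smul, smul_smul, ← hp]
  congr 2
  · have h2 : ((-1 : K) ^ p.1) * (-1) ^ p.1 = 1 := by
      rw [← pow_add, Even.neg_one_pow ⟨_, rfl⟩]
    simp only [Prod.fst_swap, pow_add]
    linear_combination (-(-1 : K) ^ p.2) * h2
  · simp [mul_assoc]

/-- Iterated `q`-commutators. -/
noncomputable def iterComm (v : K) (c : ℤ) (x y : A) : ℕ → A
  | 0 => y
  | n + 1 => x * iterComm v c x y n - v ^ (c + 2 * n) • (iterComm v c x y n * x)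

lemma mul_divPow {v : K} (hv : v ≠ 0) (h : ∀ n : ℤ, 0 < n → v ^ n ≠ 1) (n : ℕ) (x : A) :
    x * divPow v n x = qInt v ((n : ℤ) + 1) • divPow v (n + 1) x := by
  rw [divPow, divPow, smul_smul, qFact_succ, mul_smul_comm, pow_succ']
  congr 1
  have := qInt_ne_zero hv h n
  rw [mul_inv, mul_comm, mul_assoc, inv_mul_cancel₀ this, mul_one]

lemma divPow_mul {v : K} (hv : v ≠ 0) (h : ∀ n : ℤ, 0 < n → v ^ n ≠ 1) (n : ℕ) (x : A) :
    divPow v n x * x = qInt v ((n : ℤ) + 1) • divPow v (n + 1) x := by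
  rw [← mul_divPow hv h, divPow, mul_smul_comm, smul_mul_assoc, ← pow_succ, ← pow_succ']

lemma qInt_identity {v : K} (hv : v ≠ 0) (a b : ℤ) :
    qInt v a + v ^ (a + b) * qInt v b = qInt v (a + b) * v ^ b := by
  simp only [qInt, ← mul_div_assoc, ← add_div, div_mul_eq_mul_div]
  congr 1
  simp only [mul_sub, sub_mul, ← zpow_add₀ hv]
  ring_nf

lemma iterComm_eq {v : K} (hv : v ≠ 0) (h : ∀ n : ℤ, 0 < n → v ^ n ≠ 1) (c : ℤ) (x y : A)
    (n : ℕ) : iterComm v c x y n = qFact v n • ∑ p ∈ Finset.HasAntidiagonal.antidiagonal n,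
      ((-1 : K) ^ p.2 * v ^ ((p.2 : ℤ) * (c + n - 1))) •
        (divPow v p.1 x * y * divPow v p.2 x) := by
  induction n with
  | zero => simp [iterComm, divPow, qFact]
  | succ n ih =>
    rw [iterComm, ih, qFact_succ, mul_smul, mul_smul_comm, smul_mul_assoc, smul_comm (v ^ _),
      ← smul_sub]
    congr 1
    have e1 : x * ∑ p ∈ Finset.HasAntidiagonal.antidiagonal n,
        ((-1 : K) ^ p.2 * v ^ ((p.2 : ℤ) * (c + n - 1))) • (divPow v p.1 x * y * divPow v p.2 x)
        = ∑ p ∈ Finset.HasAntidiagonal.antidiagonal (n + 1),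
        ((-1 : K) ^ p.2 * v ^ ((p.2 : ℤ) * (c + n - 1)) * qInt v p.1) •
          (divPow v p.1 x * y * divPow v p.2 x) := by
      rw [Finset.Nat.sum_antidiagonal_succ, Finset.mul_sum]
      have : qInt v ((0 : ℕ) : ℤ) = 0 := by simp [qInt]
      simp only [this, mul_zero, zero_smul, zero_add]
      refine Finset.sum_congr rfl fun p _ => ?_
      rw [mul_smul_comm, ← mul_assoc, ← mul_assoc, mul_divPow hv h, smul_mul_assoc,
        smul_mul_assoc, smul_smul]
      push_cast
      rfl
    have e2 : (∑ p ∈ Finset.HasAntidiagonal.antidiagonal n,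
        ((-1 : K) ^ p.2 * v ^ ((p.2 : ℤ) * (c + n - 1))) • (divPow v p.1 x * y * divPow v p.2 x)) * x
        = ∑ p ∈ Finset.HasAntidiagonal.antidiagonal (n + 1),
        (-(-1 : K) ^ p.2 * v ^ (((p.2 : ℤ) - 1) * (c + n - 1)) * qInt v p.2) •
          (divPow v p.1 x * y * divPow v p.2 x) := by
      rw [Finset.Nat.sum_antidiagonal_succ', Finset.sum_mul]
      have : qInt v ((0 : ℕ) : ℤ) = 0 := by simp [qInt]
      simp only [this, mul_zero, zero_smul, zero_add]
      refine Finset.sum_congr rfl fun p _ => ?_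
      rw [smul_mul_assoc, mul_assoc, divPow_mul hv h, mul_smul_comm, smul_smul]
      push_cast
      congr 2
      rw [pow_succ]
      ring_nf
    rw [e1, e2, Finset.smul_sum, Finset.smul_sum, ← Finset.sum_sub_distrib]
    refine Finset.sum_congr rfl fun p hp => ?_
    rw [Finset.HasAntidiagonal.mem_antidiagonal] at hp
    rw [smul_smul, smul_smul, ← sub_smul]
    congr 1
    have hn : ((n : ℤ) + 1) = p.1 + p.2 := by exact_mod_cast hp.symm
    have key := qInt_identity hv (p.1 : ℤ) (p.2 : ℤ)
    have z1 : v ^ (c + 2 * (n : ℤ)) * v ^ (((p.2 : ℤ) - 1) * (c + n - 1))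
        = v ^ ((p.2 : ℤ) * (c + n - 1)) * v ^ ((p.1 : ℤ) + p.2) := by
      rw [← zpow_add₀ hv, ← zpow_add₀ hv, ← hn]; ring_nf
    have z2 : v ^ ((p.2 : ℤ) * (c + (n + 1 : ℕ) - 1))
        = v ^ ((p.2 : ℤ) * (c + n - 1)) * v ^ (p.2 : ℤ) := by
      rw [← zpow_add₀ hv]; push_cast; ring_nf
    rw [z2, hn]
    linear_combination ((-1 : K) ^ p.2 * v ^ ((p.2 : ℤ) * (c + n - 1))) * key
      + ((-1 : K) ^ p.2 * qInt v p.2) * z1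

lemma iterComm_eq_serre {v : K} (hv : v ≠ 0) (h : ∀ n : ℤ, 0 < n → v ^ n ≠ 1) (m : ℕ) (x y : A) :
    iterComm v (1 - m) x y m = ((-1) ^ m * qFact v m) • serre v m x y := by
  rw [iterComm_eq hv h, serre_eq_antidiagonal, mul_comm, mul_smul]
  congr 1
  rw [Finset.smul_sum]
  refine Finset.sum_congr rfl fun p hp => ?_
  rw [Finset.HasAntidiagonal.mem_antidiagonal] at hp
  rw [smul_smul]
  congr 1
  have h2 : ((-1 : K) ^ p.1) * (-1) ^ p.1 = 1 := by
    rw [← pow_add, Even.neg_one_pow ⟨_, rfl⟩]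
  rw [← hp, pow_add, show (1 - ((p.1 + p.2 : ℕ) : ℤ) + ((p.1 + p.2 : ℕ) : ℤ) - 1) = 0 by ring]
  simp only [mul_zero, zpow_zero, mul_one]
  linear_combination (-(-1 : K) ^ p.2) * h2

lemma serre_eq_zero_iff {v : K} (hv : v ≠ 0) (h : ∀ n : ℤ, 0 < n → v ^ n ≠ 1) (m : ℕ) (x y : A) :
    serre v m x y = 0 ↔ iterComm v (1 - m) x y m = 0 := by
  rw [iterComm_eq_serre hv h, smul_eq_zero_iff_right]
  exact mul_ne_zero (pow_ne_zero _ (by simp)) (qFact_ne_zero hv h m)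

lemma mul_iterComm {v : K} (hv : v ≠ 0) (c : ℤ) {x x' y : A}
    (h1 : x' * x = v ^ (2 : ℤ) • (x * x')) (h2 : x' * y = v ^ c • (y * x')) (n : ℕ) :
    x' * iterComm v c x y n = v ^ (c + 2 * n) • (iterComm v c x y n * x') := by
  induction n with
  | zero => simpa [iterComm] using h2
  | succ n ih =>
    have a1 : x' * (x * iterComm v c x y n)
        = v ^ (c + 2 * (n + 1 : ℕ)) • (x * iterComm v c x y n * x') := by
      rw [← mul_assoc, h1, smul_mul_assoc, mul_assoc, ih, mul_smul_comm, smul_smul,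
        ← zpow_add₀ hv, mul_assoc]
      congr 2; push_cast; ring
    have a2 : x' * (iterComm v c x y n * x)
        = v ^ (c + 2 * (n + 1 : ℕ)) • (iterComm v c x y n * x * x') := by
      rw [← mul_assoc, ih, smul_mul_assoc, mul_assoc, h1, mul_smul_comm, smul_smul,
        ← zpow_add₀ hv, mul_assoc]
      congr 2; push_cast; ring
    rw [iterComm, mul_sub, mul_smul_comm, a1, a2, sub_mul, smul_sub, smul_mul_assoc,
      smul_comm (v ^ (c + 2 * (n : ℤ)))]

lemma iterComm_add {v : K} (hv : v ≠ 0) (c : ℤ) {x x' y : A}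
    (h1 : x' * x = v ^ (2 : ℤ) • (x * x')) (h2 : x' * y = v ^ c • (y * x')) (n : ℕ) :
    iterComm v c (x + x') y n = iterComm v c x y n := by
  induction n with
  | zero => rfl
  | succ n ih =>
    rw [iterComm, ih, add_mul, mul_add, mul_iterComm hv c h1 h2, iterComm, smul_add]
    abel

lemma inv_generic {v : K} (h : ∀ n : ℤ, 0 < n → v ^ n ≠ 1) :
    ∀ n : ℤ, 0 < n → v⁻¹ ^ n ≠ 1 := by
  intro n hn h0
  rw [inv_zpow, inv_eq_one] at h0
  exact h n hn h0

lemma swap_smul {s : K} (hs : s ≠ 0) {a b : A} (h : a = s • b) : b = s⁻¹ • a := by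
  rw [h, smul_smul, inv_mul_cancel₀ hs, one_smul]

lemma serre_add_add {v : K} (hv : v ≠ 0) (h : ∀ n : ℤ, 0 < n → v ^ n ≠ 1) (m : ℕ)
    {x x' y y' : A}
    (h1 : x' * x = v ^ (2 : ℤ) • (x * x')) (h2 : x' * y = v ^ (1 - m : ℤ) • (y * x'))
    (h3 : y' * x = v ^ (1 - m : ℤ) • (x * y'))
    (hs : serre v m x y = 0) (hs' : serre v m x' y' = 0) :
    serre v m (x + x') (y + y') = 0 := by
  rw [serre_add]
  have a1 : serre v m (x + x') y = 0 := by
    rw [serre_eq_zero_iff hv h, iterComm_add hv _ h1 h2, ← serre_eq_zero_iff hv h, hs]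
  have a2 : serre v m (x + x') y' = 0 := by
    have k1 := swap_smul (zpow_ne_zero _ hv) h1
    have k3 := swap_smul (zpow_ne_zero _ hv) h3
    rw [← inv_zpow] at k1 k3
    have hv' := inv_ne_zero hv
    rw [← serre_inv] at hs' ⊢
    rw [add_comm, serre_eq_zero_iff hv' (inv_generic h), iterComm_add hv' _ k1 k3,
      ← serre_eq_zero_iff hv' (inv_generic h), hs']
  rw [a1, a2, add_zero]

lemma iterComm_mul {v : K} (hv : v ≠ 0) (c : ℤ) {x y g g' : A}
    (hgg : g * g' = g' * g)
    (h1 : x * g = v ^ (2 : ℤ) • (g * x)) (h2 : x * g' = v ^ c • (g' * x))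
    (h3 : y * g = v ^ c • (g * y)) (n : ℕ) :
    ∃ s : K, iterComm v c (g * x) (g' * y) n = s • (g ^ n * g' * iterComm v c x y n) := by
  have b1 : ∀ n : ℕ, x * (g ^ n * g') = v ^ (c + 2 * n) • (g ^ n * g' * x) := by
    intro n
    induction n with
    | zero => simpa using h2
    | succ n ih =>
      rw [pow_succ', mul_assoc, ← mul_assoc x, h1, smul_mul_assoc, mul_assoc, ih, mul_smul_comm,
        smul_smul, ← zpow_add₀ hv, ← mul_assoc, ← mul_assoc]
      congr 2; push_cast; ring
  have b2 : ∀ n : ℕ, iterComm v c x y n * g = v ^ (c + 2 * n) • (g * iterComm v c x y n) := by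
    intro n
    induction n with
    | zero => simpa [iterComm] using h3
    | succ n ih =>
      have a1 : x * iterComm v c x y n * g
          = v ^ (c + 2 * (n + 1 : ℕ)) • (g * (x * iterComm v c x y n)) := by
        rw [mul_assoc, ih, mul_smul_comm, ← mul_assoc, h1, smul_mul_assoc, smul_smul,
          ← zpow_add₀ hv, mul_assoc]
        congr 2; push_cast; ring
      have a2 : iterComm v c x y n * x * g
          = v ^ (c + 2 * (n + 1 : ℕ)) • (g * (iterComm v c x y n * x)) := by
        rw [mul_assoc, h1, mul_smul_comm, ← mul_assoc, ih, smul_mul_assoc, smul_smul,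
          ← zpow_add₀ hv, mul_assoc]
        congr 2; push_cast; ring
      rw [iterComm, sub_mul, smul_mul_assoc, a1, a2, mul_sub, smul_sub, mul_smul_comm,
        smul_comm (v ^ (c + 2 * (n : ℤ)))]
  induction n with
  | zero => exact ⟨1, by simp [iterComm]⟩
  | succ n ih =>
    obtain ⟨s, hs⟩ := ih
    refine ⟨s * v ^ (c + 2 * (n : ℤ)), ?_⟩
    have hg : g ^ n * g' * g = g ^ (n + 1) * g' := by
      rw [mul_assoc, ← hgg, ← mul_assoc, pow_succ]
    have a1 : g * x * (g ^ n * g' * iterComm v c x y n)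
        = v ^ (c + 2 * (n : ℤ)) • (g ^ (n + 1) * g' * (x * iterComm v c x y n)) := by
      rw [mul_assoc g x, ← mul_assoc x, b1, smul_mul_assoc, mul_smul_comm]
      congr 1
      rw [pow_succ']
      simp only [mul_assoc]
    have a2 : (g ^ n * g' * iterComm v c x y n) * (g * x)
        = v ^ (c + 2 * (n : ℤ)) • (g ^ (n + 1) * g' * (iterComm v c x y n * x)) := by
      rw [mul_assoc _ _ (g * x), ← mul_assoc _ g x, b2, smul_mul_assoc, mul_smul_comm, ← hg]
      simp only [mul_assoc]
    rw [iterComm, hs, mul_smul_comm, smul_mul_assoc, a1, a2, iterComm, mul_sub, smul_sub,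
      mul_smul_comm]
    simp only [smul_smul]
    congr 2
    ring

lemma serre_mul_mul {v : K} (hv : v ≠ 0) (h : ∀ n : ℤ, 0 < n → v ^ n ≠ 1) (m : ℕ)
    {x y g g' : A} (hgg : g * g' = g' * g)
    (h1 : x * g = v ^ (2 : ℤ) • (g * x)) (h2 : x * g' = v ^ (1 - m : ℤ) • (g' * x))
    (h3 : y * g = v ^ (1 - m : ℤ) • (g * y)) (hs : serre v m x y = 0) :
    serre v m (g * x) (g' * y) = 0 := by
  rw [serre_eq_zero_iff hv h] at hs ⊢
  obtain ⟨s, hs'⟩ := iterComm_mul hv (1 - m) hgg h1 h2 h3 m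
  rw [hs', hs, mul_zero, smul_zero]

lemma serre_mul_of_commute (v : K) (m : ℕ) {x y g g' : A} (hg' : Commute g g')
    (h1 : Commute g x) (h2 : Commute g' x) (h3 : Commute g y) (hs : serre v m x y = 0) :
    serre v m (g * x) (g' * y) = 0 := by
  have key : serre v m (g * x) (g' * y) = g ^ m * g' * serre v m x y := by
    rw [serre_eq_antidiagonal, serre_eq_antidiagonal, Finset.mul_sum]
    refine Finset.sum_congr rfl fun p hp => ?_
    rw [Finset.HasAntidiagonal.mem_antidiagonal] at hp
    rw [mul_smul_comm]
    congr 1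
    simp only [divPow, smul_mul_assoc, mul_smul_comm]
    congr 2
    rw [h1.mul_pow, h1.mul_pow, ← hp, pow_add]
    have c1 : g' * x ^ p.1 = x ^ p.1 * g' := (h2.pow_right _).eq
    have c2 : g ^ p.2 * x ^ p.1 = x ^ p.1 * g ^ p.2 := (h1.pow_pow _ _).eq
    have c3 : g ^ p.2 * y = y * g ^ p.2 := (h3.pow_left _).eq
    have c4 : g ^ p.2 * g' = g' * g ^ p.2 := (hg'.pow_left _).eq
    calc g ^ p.1 * x ^ p.1 * (g' * y) * (g ^ p.2 * x ^ p.2)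
        = g ^ p.1 * (x ^ p.1 * g') * (y * g ^ p.2) * x ^ p.2 := by simp only [mul_assoc]
      _ = g ^ p.1 * g' * (x ^ p.1 * g ^ p.2) * y * x ^ p.2 := by
          rw [← c1, ← c3]; simp only [mul_assoc]
      _ = g ^ p.1 * (g' * g ^ p.2) * x ^ p.1 * y * x ^ p.2 := by
          rw [← c2]; simp only [mul_assoc]
      _ = g ^ p.1 * g ^ p.2 * g' * (x ^ p.1 * y * x ^ p.2) := by
          rw [← c4]; simp only [mul_assoc]
  rw [key, hs, mul_zero]

end Aux

/-! ### Auxiliary facts: relations in the quantum group -/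

lemma CartanDatum.two_d (C : CartanDatum I) (i : I) : 2 * C.d i = C.dot i i := by
  obtain ⟨r, hr⟩ := C.dot_self_even i
  simp only [CartanDatum.d]; omega

lemma CartanDatum.d_pos (C : CartanDatum I) (i : I) : 0 < C.d i := by
  have := C.two_d i
  have := C.dot_self_pos i
  omega

lemma CartanDatum.q_ne_zero (C : CartanDatum I) (i : I) : C.q i ≠ 0 :=
  zpow_ne_zero _ QuantumAdjoint.q_ne_zero

lemma CartanDatum.q_generic (C : CartanDatum I) (i : I) : ∀ n : ℤ, 0 < n → C.q i ^ n ≠ 1 := by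
  intro n hn
  rw [CartanDatum.q, ← zpow_mul]
  exact q_zpow_ne_one (mul_pos (C.d_pos i) hn)

namespace RootDatum

variable (D : RootDatum C X Y)

lemma d_mul_c (i j : I) : C.d i * D.c i j = C.dot i j := by
  have h1 := D.pairing_coroot_root i j
  rw [← C.two_d, mul_assoc] at h1
  exact mul_left_cancel₀ two_ne_zero h1

lemma pairing_h (i j : I) : D.pairing (D.h i) (D.root j) = C.dot i j := by
  rw [h, map_smul, LinearMap.smul_apply, smul_eq_mul]
  exact D.d_mul_c i j

lemma one_sub_toNat {i j : I} (hij : i ≠ j) :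
    (1 - ((1 - D.c i j).toNat : ℤ)) = D.c i j := by
  have h1 := D.d_mul_c i j
  have h2 := C.d_pos i
  have h3 : C.dot i j ≤ 0 := by
    have a := C.dot_self_dvd i j hij
    have b := C.dot_nonpos i j hij
    have e := Int.mul_ediv_cancel' a
    have p := C.dot_self_pos i
    nlinarith
  have h4 : D.c i j ≤ 0 := by
    by_contra hc
    push Not at hc
    have := mul_pos h2 hc
    omega
  rw [Int.toNat_of_nonneg (by omega)]
  ring

lemma k_zero : D.k 0 = 1 := by
  have := RingQuot.mkAlgHom_rel K (Rel.k_zero (D := D))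
  rw [map_one] at this
  exact this

lemma k_mul_k (μ ν : Y) : D.k μ * D.k ν = D.k (μ + ν) := by
  have := RingQuot.mkAlgHom_rel K (Rel.k_add (D := D) μ ν)
  rw [map_mul] at this
  exact this

lemma k_comm (μ ν : Y) : D.k μ * D.k ν = D.k ν * D.k μ := by
  rw [k_mul_k, k_mul_k, add_comm]

lemma k_mul_e (μ : Y) (i : I) :
    D.k μ * D.e i = q ^ D.pairing μ (D.root i) • (D.e i * D.k μ) := by
  have := RingQuot.mkAlgHom_rel K (Rel.k_e (D := D) μ i)
  rw [map_mul, map_smul, map_mul] at this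
  exact this

lemma k_mul_f (μ : Y) (i : I) :
    D.k μ * D.f i = q ^ (-D.pairing μ (D.root i)) • (D.f i * D.k μ) := by
  have := RingQuot.mkAlgHom_rel K (Rel.k_f (D := D) μ i)
  rw [map_mul, map_smul, map_mul] at this
  exact this

lemma e_mul_k (μ : Y) (i : I) :
    D.e i * D.k μ = q ^ (-D.pairing μ (D.root i)) • (D.k μ * D.e i) := by
  rw [k_mul_e, smul_smul, ← zpow_add₀ q_ne_zero]; simp

lemma f_mul_k (μ : Y) (i : I) :
    D.f i * D.k μ = q ^ D.pairing μ (D.root i) • (D.k μ * D.f i) := by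
  rw [k_mul_f, smul_smul, ← zpow_add₀ q_ne_zero]; simp

lemma e_f_same (i : I) : D.e i * D.f i - D.f i * D.e i
    = (C.q i - (C.q i)⁻¹)⁻¹ • (D.k (D.h i) - D.k (-D.h i)) := by
  have := RingQuot.mkAlgHom_rel K (Rel.e_f_same (D := D) i)
  rw [map_sub, map_mul, map_mul, map_smul, map_sub] at this
  exact this

lemma e_f_ne {i j : I} (hij : i ≠ j) : D.e i * D.f j - D.f j * D.e i = 0 := by
  have := RingQuot.mkAlgHom_rel K (Rel.e_f_ne (D := D) i j hij)
  rw [map_sub, map_mul, map_mul, map_zero] at this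
  exact this

lemma serre_e {i j : I} (hij : i ≠ j) :
    serre (C.q i) (1 - D.c i j).toNat (D.e i) (D.e j) = 0 := by
  have := RingQuot.mkAlgHom_rel K (Rel.serre_e (D := D) i j hij)
  rw [map_zero] at this
  exact (map_serre D.proj _ _ _ _).symm.trans this

lemma serre_f {i j : I} (hij : i ≠ j) :
    serre (C.q i) (1 - D.c i j).toNat (D.f i) (D.f j) = 0 := by
  have := RingQuot.mkAlgHom_rel K (Rel.serre_f (D := D) i j hij)
  rw [map_zero] at this
  exact (map_serre D.proj _ _ _ _).symm.trans this

lemma q_zpow_c (i j : I) : C.q i ^ D.c i j = q ^ C.dot i j := by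
  rw [CartanDatum.q, ← zpow_mul, d_mul_c]

lemma q_zpow_two (i : I) : C.q i ^ (2 : ℤ) = q ^ C.dot i i := by
  rw [CartanDatum.q, ← zpow_mul, mul_comm, C.two_d]

/-- The universal property: an assignment of the generators that satisfies the defining relations
extends to an algebra homomorphism from `U`. -/
noncomputable def liftHom {A : Type*} [Ring A] [Algebra K A] (φ : Gen I Y → A)
    (hφ : ∀ ⦃a b⦄, Rel D a b → FreeAlgebra.lift K φ a = FreeAlgebra.lift K φ b) : D.U →ₐ[K] A :=
  RingQuot.liftAlgHom K ⟨FreeAlgebra.lift K φ, hφ⟩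

/-! ### Coproduct, antipode, adjoint action -/

/-- The values of the coproduct on the generators. -/
noncomputable def comulGen : Gen I Y → D.U ⊗[K] D.U
  | .e i => D.e i ⊗ₜ 1 + D.k (D.h i) ⊗ₜ D.e i
  | .f i => D.f i ⊗ₜ D.k (-D.h i) + 1 ⊗ₜ D.f i
  | .k μ => D.k μ ⊗ₜ D.k μ

/-- The values of the antipode on the generators. -/
noncomputable def antipodeGen : Gen I Y → D.Uᵐᵒᵖ
  | .e i => MulOpposite.op (-(D.k (-D.h i) * D.e i))
  | .f i => MulOpposite.op (-(D.f i * D.k (D.h i)))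
  | .k μ => MulOpposite.op (D.k (-μ))

lemma serre_comul_e {i j : I} (hij : i ≠ j) :
    serre (C.q i) (1 - D.c i j).toNat (D.comulGen (.e i)) (D.comulGen (.e j)) = 0 := by
  refine serre_add_add (C.q_ne_zero i) (C.q_generic i) _ ?_ ?_ ?_ ?_ ?_
  · simp only [Algebra.TensorProduct.tmul_mul_tmul, one_mul, mul_one, k_mul_e, pairing_h,
      q_zpow_two, TensorProduct.smul_tmul']
  · rw [D.one_sub_toNat hij]
    simp only [Algebra.TensorProduct.tmul_mul_tmul, one_mul, mul_one, k_mul_e, pairing_h,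
      q_zpow_c, TensorProduct.smul_tmul']
  · rw [D.one_sub_toNat hij]
    simp only [Algebra.TensorProduct.tmul_mul_tmul, one_mul, mul_one, k_mul_e, pairing_h,
      q_zpow_c, TensorProduct.smul_tmul', C.dot_comm i j]
  · have := map_serre (Algebra.TensorProduct.includeLeft (R := K) (S := K) (A := D.U) (B := D.U))
      (C.q i) (1 - D.c i j).toNat (D.e i) (D.e j)
    rw [D.serre_e hij, map_zero] at this
    exact this.symm
  · have h0 := map_serre (Algebra.TensorProduct.includeRight (R := K) (A := D.U) (B := D.U))
      (C.q i) (1 - D.c i j).toNat (D.e i) (D.e j)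
    rw [D.serre_e hij, map_zero] at h0
    have := serre_mul_of_commute (C.q i) (1 - D.c i j).toNat
      (g := D.k (D.h i) ⊗ₜ[K] (1 : D.U)) (g' := D.k (D.h j) ⊗ₜ[K] (1 : D.U))
      (by simp [commute_iff_eq, D.k_comm (D.h i)]) (by simp [commute_iff_eq])
      (by simp [commute_iff_eq]) (by simp [commute_iff_eq]) h0.symm
    simpa using this

lemma serre_comul_f {i j : I} (hij : i ≠ j) :
    serre (C.q i) (1 - D.c i j).toNat (D.comulGen (.f i)) (D.comulGen (.f j)) = 0 := by
  simp only [comulGen]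
  rw [add_comm, add_comm (D.f j ⊗ₜ[K] D.k (-D.h j))]
  refine serre_add_add (C.q_ne_zero i) (C.q_generic i) _ ?_ ?_ ?_ ?_ ?_
  · simp only [Algebra.TensorProduct.tmul_mul_tmul, one_mul, mul_one, k_mul_f, pairing_h,
      q_zpow_two, TensorProduct.tmul_smul, map_neg, LinearMap.neg_apply, neg_neg]
  · rw [D.one_sub_toNat hij]
    simp only [Algebra.TensorProduct.tmul_mul_tmul, one_mul, mul_one, k_mul_f, pairing_h,
      q_zpow_c, TensorProduct.tmul_smul, map_neg, LinearMap.neg_apply, neg_neg]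
  · rw [D.one_sub_toNat hij]
    simp only [Algebra.TensorProduct.tmul_mul_tmul, one_mul, mul_one, k_mul_f, pairing_h,
      q_zpow_c, TensorProduct.tmul_smul, map_neg, LinearMap.neg_apply, neg_neg, C.dot_comm i j]
  · have := map_serre (Algebra.TensorProduct.includeRight (R := K) (A := D.U) (B := D.U))
      (C.q i) (1 - D.c i j).toNat (D.f i) (D.f j)
    rw [D.serre_f hij, map_zero] at this
    exact this.symm
  · have h0 := map_serre (Algebra.TensorProduct.includeLeft (R := K) (S := K) (A := D.U)
      (B := D.U)) (C.q i) (1 - D.c i j).toNat (D.f i) (D.f j)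
    rw [D.serre_f hij, map_zero] at h0
    have := serre_mul_of_commute (C.q i) (1 - D.c i j).toNat
      (g := (1 : D.U) ⊗ₜ[K] D.k (-D.h i)) (g' := (1 : D.U) ⊗ₜ[K] D.k (-D.h j))
      (by simp [commute_iff_eq, D.k_comm (-D.h i)]) (by simp [commute_iff_eq])
      (by simp [commute_iff_eq]) (by simp [commute_iff_eq]) h0.symm
    simpa using this

lemma comulGen_rel ⦃a b : FreeAlgebra K (Gen I Y)⦄ (hab : Rel D a b) :
    FreeAlgebra.lift K D.comulGen a = FreeAlgebra.lift K D.comulGen b := by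
  cases hab with
  | k_zero => simp [comulGen, k_zero, Algebra.TensorProduct.one_def]
  | k_add μ ν => simp [comulGen, k_mul_k]
  | k_e μ i =>
    simp only [map_mul, map_smul, FreeAlgebra.lift_ι_apply, comulGen, mul_add, add_mul,
      Algebra.TensorProduct.tmul_mul_tmul, mul_one, one_mul, k_mul_e, smul_add,
      TensorProduct.smul_tmul', TensorProduct.tmul_smul, D.k_comm μ (D.h i)]
  | k_f μ i =>
    simp only [map_mul, map_smul, FreeAlgebra.lift_ι_apply, comulGen, mul_add, add_mul,
      Algebra.TensorProduct.tmul_mul_tmul, mul_one, one_mul, k_mul_f, smul_add,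
      TensorProduct.smul_tmul', TensorProduct.tmul_smul, D.k_comm μ (-D.h i)]
  | e_f_same i =>
    have h1 := D.e_f_same i
    simp only [map_mul, map_sub, map_smul, FreeAlgebra.lift_ι_apply, comulGen, mul_add, add_mul,
      Algebra.TensorProduct.tmul_mul_tmul, mul_one, one_mul]
    rw [D.k_mul_f, D.e_mul_k]
    simp only [pairing_h, map_neg, LinearMap.neg_apply, neg_neg, TensorProduct.tmul_smul,
      ← TensorProduct.smul_tmul', smul_smul, ← zpow_add₀ q_ne_zero, add_neg_cancel, zpow_zero,
      one_smul]
    have h2 : D.e i * D.f i = D.f i * D.e i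
        + (C.q i - (C.q i)⁻¹)⁻¹ • (D.k (D.h i) - D.k (-D.h i)) := by rw [← h1]; abel
    rw [h2]
    simp only [TensorProduct.add_tmul, TensorProduct.tmul_add, TensorProduct.tmul_smul,
      ← TensorProduct.smul_tmul', TensorProduct.sub_tmul, TensorProduct.tmul_sub, smul_sub]
    abel
  | e_f_ne i j hij =>
    have h1 := D.e_f_ne hij
    simp only [map_mul, map_sub, map_zero, FreeAlgebra.lift_ι_apply, comulGen, mul_add, add_mul,
      Algebra.TensorProduct.tmul_mul_tmul, mul_one, one_mul]
    rw [D.k_mul_f, D.e_mul_k]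
    simp only [pairing_h, map_neg, LinearMap.neg_apply, neg_neg, TensorProduct.tmul_smul,
      ← TensorProduct.smul_tmul', smul_smul, ← zpow_add₀ q_ne_zero, C.dot_comm i j,
      add_neg_cancel, zpow_zero, one_smul]
    rw [sub_eq_zero.1 h1]
    abel
  | serre_e i j hij =>
    rw [map_serre, map_zero, FreeAlgebra.lift_ι_apply, FreeAlgebra.lift_ι_apply]
    exact D.serre_comul_e hij
  | serre_f i j hij =>
    rw [map_serre, map_zero, FreeAlgebra.lift_ι_apply, FreeAlgebra.lift_ι_apply]
    exact D.serre_comul_f hij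

/-- The coproduct `Δ : U → U ⊗ U`. -/
noncomputable def comul : D.U →ₐ[K] D.U ⊗[K] D.U := D.liftHom D.comulGen D.comulGen_rel

lemma serre_antipode_e {i j : I} (hij : i ≠ j) :
    serre (C.q i) (1 - D.c i j).toNat (D.antipodeGen (.e i)) (D.antipodeGen (.e j)) = 0 := by
  simp only [antipodeGen]
  rw [serre_op, ← neg_mul, ← neg_mul, serre_mul_mul (C.q_ne_zero i) (C.q_generic i) _ ?_ ?_ ?_ ?_
    (D.serre_e hij)]
  · simp
  · simp [D.k_comm (-D.h i)]
  · simp only [mul_neg, neg_mul, smul_neg, e_mul_k, pairing_h, map_neg, LinearMap.neg_apply,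
      neg_neg, q_zpow_two]
  · rw [D.one_sub_toNat hij]
    simp only [mul_neg, neg_mul, smul_neg, e_mul_k, pairing_h, map_neg, LinearMap.neg_apply,
      neg_neg, q_zpow_c, C.dot_comm i j]
  · rw [D.one_sub_toNat hij]
    simp only [mul_neg, neg_mul, smul_neg, e_mul_k, pairing_h, map_neg, LinearMap.neg_apply,
      neg_neg, q_zpow_c]

lemma serre_antipode_f {i j : I} (hij : i ≠ j) :
    serre (C.q i) (1 - D.c i j).toNat (D.antipodeGen (.f i)) (D.antipodeGen (.f j)) = 0 := by
  simp only [antipodeGen]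
  have hf : ∀ l, -(D.f l * D.k (D.h l)) = (-(q ^ C.dot l l • D.k (D.h l))) * D.f l := by
    intro l
    rw [f_mul_k, pairing_h, neg_mul, smul_mul_assoc]
  rw [serre_op, hf, hf, serre_mul_mul (C.q_ne_zero i) (C.q_generic i) _ ?_ ?_ ?_ ?_
    (D.serre_f hij)]
  · simp
  · simp only [mul_neg, neg_mul, smul_neg, mul_smul_comm, smul_mul_assoc, D.k_comm (D.h i)]
    rw [smul_comm]
  · simp only [mul_neg, neg_mul, smul_neg, mul_smul_comm, smul_mul_assoc, f_mul_k, pairing_h,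
      q_zpow_two]
  · rw [D.one_sub_toNat hij]
    simp only [mul_neg, neg_mul, smul_neg, mul_smul_comm, smul_mul_assoc, f_mul_k, pairing_h,
      q_zpow_c, C.dot_comm i j]
    rw [smul_comm]
  · rw [D.one_sub_toNat hij]
    simp only [mul_neg, neg_mul, smul_neg, mul_smul_comm, smul_mul_assoc, f_mul_k, pairing_h,
      q_zpow_c]
    rw [smul_comm]

lemma antipode_e_f (i j : I) :
    D.f j * D.k (D.h j) * (D.k (-D.h i) * D.e i) - D.k (-D.h i) * D.e i * (D.f j * D.k (D.h j))
      = -(q ^ (C.dot j j - C.dot i j) •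
        (D.k (-D.h i) * D.k (D.h j) * (D.e i * D.f j - D.f j * D.e i))) := by
  have a1 : D.f j * D.k (D.h j) * (D.k (-D.h i) * D.e i)
      = q ^ (C.dot j j - C.dot i j) • (D.k (-D.h i) * D.k (D.h j) * (D.f j * D.e i)) := by
    rw [← mul_assoc, mul_assoc (D.f j), k_mul_k, add_comm, f_mul_k, k_mul_k, smul_mul_assoc,
      mul_assoc, map_add, LinearMap.add_apply, map_neg, LinearMap.neg_apply, pairing_h, pairing_h,
      neg_add_eq_sub]
  have a2 : D.k (-D.h i) * D.e i * (D.f j * D.k (D.h j))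
      = q ^ (C.dot j j - C.dot i j) • (D.k (-D.h i) * D.k (D.h j) * (D.e i * D.f j)) := by
    rw [f_mul_k, mul_smul_comm, mul_assoc, ← mul_assoc (D.e i), e_mul_k, smul_mul_assoc,
      mul_smul_comm, smul_smul, ← zpow_add₀ q_ne_zero, pairing_h, pairing_h, C.dot_comm j i,
      ← sub_eq_add_neg]
    simp only [mul_assoc]
  rw [a1, a2, mul_sub, smul_sub, neg_sub]

lemma antipodeGen_rel ⦃a b : FreeAlgebra K (Gen I Y)⦄ (hab : Rel D a b) :
    FreeAlgebra.lift K D.antipodeGen a = FreeAlgebra.lift K D.antipodeGen b := by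
  cases hab with
  | k_zero => simp [antipodeGen, k_zero]
  | k_add μ ν =>
    simp only [map_mul, FreeAlgebra.lift_ι_apply, antipodeGen, ← MulOpposite.op_mul, k_mul_k,
      neg_add_rev]
  | k_e μ i =>
    simp only [map_mul, map_smul, FreeAlgebra.lift_ι_apply, antipodeGen, ← MulOpposite.op_mul,
      ← MulOpposite.op_smul]
    congr 1
    rw [neg_mul, mul_assoc, e_mul_k, mul_smul_comm, ← mul_assoc, D.k_comm (-D.h i), mul_neg,
      smul_neg, mul_assoc, map_neg, LinearMap.neg_apply, neg_neg]
  | k_f μ i =>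
    simp only [map_mul, map_smul, FreeAlgebra.lift_ι_apply, antipodeGen, ← MulOpposite.op_mul,
      ← MulOpposite.op_smul]
    congr 1
    rw [neg_mul, mul_assoc, D.k_comm (D.h i), ← mul_assoc, f_mul_k, smul_mul_assoc, mul_neg,
      smul_neg, mul_assoc, map_neg, LinearMap.neg_apply]
  | e_f_same i =>
    simp only [map_mul, map_sub, map_smul, FreeAlgebra.lift_ι_apply, antipodeGen,
      ← MulOpposite.op_mul, ← MulOpposite.op_smul, ← MulOpposite.op_sub]
    congr 1
    rw [neg_mul_neg, neg_mul_neg, antipode_e_f, sub_self, zpow_zero, one_smul, k_mul_k,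
      neg_add_cancel, k_zero, one_mul, e_f_same, ← smul_neg, neg_sub, neg_neg]
  | e_f_ne i j hij =>
    simp only [map_mul, map_sub, map_zero, FreeAlgebra.lift_ι_apply, antipodeGen,
      ← MulOpposite.op_mul, ← MulOpposite.op_sub]
    rw [neg_mul_neg, neg_mul_neg, antipode_e_f, e_f_ne D hij]
    simp
  | serre_e i j hij =>
    rw [map_serre, map_zero, FreeAlgebra.lift_ι_apply, FreeAlgebra.lift_ι_apply]
    exact D.serre_antipode_e hij
  | serre_f i j hij =>
    rw [map_serre, map_zero, FreeAlgebra.lift_ι_apply, FreeAlgebra.lift_ι_apply]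
    exact D.serre_antipode_f hij

/-- The antipode, as an algebra homomorphism `S : U → Uᵒᵖ`. -/
noncomputable def antipode : D.U →ₐ[K] D.Uᵐᵒᵖ := D.liftHom D.antipodeGen D.antipodeGen_rel

/-- The left adjoint action `ad_z y = ∑ z₁ y S(z₂)`, where `Δ z = ∑ z₁ ⊗ z₂`. -/
noncomputable def ad : D.U →ₐ[K] Module.End K D.U :=
  (AlgHom.mulLeftRight K D.U).comp
    ((Algebra.TensorProduct.map (AlgHom.id K D.U) D.antipode).comp D.comul)

/-! ### The subalgebras `U⁺`, `U_i` and `U⁺[i]` -/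

/-- The subalgebra `U⁺` generated by the `e_j`. -/
noncomputable def UPlus : Subalgebra K D.U := Algebra.adjoin K (Set.range D.e)

/-- The subalgebra `U_i` generated by `e_i`, `f_i` and `k_i`. -/
noncomputable def USub (i : I) : Subalgebra K D.U :=
  Algebra.adjoin K {D.e i, D.f i, D.k (D.h i)}

/-- The subalgebra `U⁺[i]` generated by the elements `ad_{e_i}^(n) (e_j)` for `j ≠ i`, `n ≥ 0`. -/
noncomputable def UPlusSub (i : I) : Subalgebra K D.U :=
  Algebra.adjoin K {y | ∃ (j : I) (n : ℕ), j ≠ i ∧ y = divPow (C.q i) n (D.ad (D.e i)) (D.e j)}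

/-- `e_i` as an element of `U_i`. -/
noncomputable def eSub (i : I) : D.USub i := ⟨D.e i, Algebra.subset_adjoin (by simp)⟩

/-- `f_i` as an element of `U_i`. -/
noncomputable def fSub (i : I) : D.USub i := ⟨D.f i, Algebra.subset_adjoin (by simp)⟩

/-- `k_i` as an element of `U_i`. -/
noncomputable def kSub (i : I) : D.USub i := ⟨D.k (D.h i), Algebra.subset_adjoin (by simp)⟩

/-! ### Integrable representations of `U_i` -/

section Representation

variable {V : Type*} [AddCommGroup V] [Module K V]

/-- The weight space of weight `n`: the vectors `v` with `k_i v = q_i ^ n v`. -/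
noncomputable def weightSpace (i : I) (ρ : D.USub i →ₐ[K] Module.End K V) (n : ℤ) :
    Submodule K V := Module.End.eigenspace (ρ (D.kSub i)) (C.q i ^ n)

/-- A representation of `U_i` is integrable if it is the direct sum of its weight spaces and
`e_i`, `f_i` act locally nilpotently. -/
def IsIntegrable (i : I) (ρ : D.USub i →ₐ[K] Module.End K V) : Prop :=
  DirectSum.IsInternal (D.weightSpace i ρ) ∧
    ∀ v : V, ∃ n : ℕ, (ρ (D.eSub i) ^ n) v = 0 ∧ (ρ (D.fSub i) ^ n) v = 0

end Representation

/-- A subspace `V` of `U` is stable under the adjoint action of `U_i`. -/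
def IsAdStable (i : I) (V : Submodule K D.U) : Prop :=
  ∀ z ∈ D.USub i, ∀ y ∈ V, D.ad z y ∈ V

/-- The adjoint representation of `U_i` on a stable subspace of `U`. -/
noncomputable def adRep (i : I) (V : Submodule K D.U) (hV : D.IsAdStable i V) :
    D.USub i →ₐ[K] Module.End K V :=
  AlgHom.ofLinearMap
    { toFun := fun z => (D.ad z).restrict (hV z z.2)
      map_add' := fun z w => by ext y; simp
      map_smul' := fun a z => by ext y; simp }
    (by ext y; simp) (fun z w => by ext y; simp)

end RootDatum

end QuantumAdjoint

namespace QuantumAdjoint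

/-! ### Commutation of the Serre elements with the opposite generators -/

section Commutation

variable {A : Type*} [Ring A] [Algebra K A]

/-! Write `h = d_i i^∨`, so that `k_i = k_h`. The operators `ad_{e_i}` and `ad_{f_i}` are skew
derivations and `ad_{k_i}` is conjugation by `k_i`, so stability and integrability of `U⁺[i]` reduce
to its generators. There the situation is that of quantum `sl₂`: `e_j` is a lowest weight vector
(`ad_{f_i} e_j = 0`), `ad_{e_i}^n (e_j)` is an iterated `q`-commutator, and the quantum Serre
relation says exactly that the string stops at `n = 1 - c_{i,j}` (`adPow_eq_zero`).

Maximality follows from a sharper fact: if `x` and `ad_{f_i} x` both lie in `U⁺`, then `x ∈ U⁺[i]`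
(`mem_uPlusSub_of_ad_f_mem`). Every `x ∈ U⁺` is a sum of terms `y_n e_i^n` with `y_n ∈ U⁺[i]`
(`exists_eq_sum_mul_pow`). Applying `ad_{f_i}` produces elements of `U⁺` together with `(∑ s_n
y_{n+1} e_i^n) k_i²`, where all `s_n` are nonzero (`ad_f_pow_succ`). If `U⁺ ∩ U⁺ k_i² = 0`, this
last sum vanishes. The same argument, applied repeatedly, shows that the powers of `e_i` are
independent over `U⁺[i]`, hence `y_n = 0` for `n ≥ 1` and `x = y_0`.

The vanishing of `U⁺ ∩ U⁺ k_i²` (`eq_zero_of_mul_k_mem`) is obtained without a triangular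
decomposition. It needs one representation of `U` with a nonzero vector `v` of weight `α_i` killed
by all `e_j`. On the tensor product with the left regular representation, `u ∈ U⁺` sends `v ⊗ y` to
`v ⊗ k_i u k_i⁻¹ y`, while `k_i²` contributes the extra scalar `q^(2 i·i) ≠ 1`. The representation
is built on words in the `f_j` and divided by a radical; the Serre relations hold there because
Serre elements commute with the opposite generators. -/

lemma comm_iterComm_succ (v : K) (c : ℤ) (x y f : A) (n : ℕ) :
    f * iterComm v c x y (n + 1) - iterComm v c x y (n + 1) * f
      = ((f * x - x * f) * iterComm v c x y n
          - v ^ (c + 2 * n) • (iterComm v c x y n * (f * x - x * f)))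
        + (x * (f * iterComm v c x y n - iterComm v c x y n * f)
          - v ^ (c + 2 * n) • ((f * iterComm v c x y n - iterComm v c x y n * f) * x)) := by
  simp only [iterComm, mul_sub, sub_mul, mul_smul_comm, smul_mul_assoc, smul_sub, mul_assoc]
  abel

/-- Bracketing `f` with one step of the `q`-commutator replaces `x` by a multiple of `κ' - κ`. The
iterated commutator is a weight vector for `κ`, and the exponent of `v` in that step is its weight,
so the `κ` parts cancel and only `κ'` survives. Moving `κ'` past `x` then turns the previous
coefficient into that of the next step, so the contributions add up. -/
lemma comm_iterComm {v : K} (hv : v ≠ 0) (c : ℤ) {x y f κ κ' : A} {s : K}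
    (h1 : κ * x = v ^ (2 : ℤ) • (x * κ)) (h2 : κ * y = v ^ c • (y * κ))
    (hκ : κ * κ' = 1) (hκ' : κ' * κ = 1) (hx : x * f - f * x = s • (κ - κ')) (hy : Commute f y)
    (n : ℕ) :
    f * iterComm v c x y (n + 1) - iterComm v c x y (n + 1) * f
      = -((s * ∑ l ∈ Finset.range (n + 1), (v ^ (c + 2 * l) - v ^ (-(c + 2 * l)))) •
        (iterComm v c x y n * κ')) := by
  have hx' : f * x - x * f = s • (κ' - κ) := by
    rw [← neg_sub, hx, ← smul_neg, neg_sub]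
  have hz : ∀ n, κ * iterComm v c x y n = v ^ (c + 2 * n) • (iterComm v c x y n * κ) :=
    mul_iterComm hv c h1 h2
  have inv : ∀ {z : A} {w : K}, w ≠ 0 → κ * z = w • (z * κ) → κ' * z = w⁻¹ • (z * κ') := by
    intro z w hw h
    have : z * κ' = w • (κ' * z) := by
      calc z * κ' = κ' * (κ * z) * κ' := by rw [← mul_assoc κ', hκ', one_mul]
        _ = w • (κ' * z) := by
          rw [h, mul_smul_comm, smul_mul_assoc, ← mul_assoc, mul_assoc _ κ, hκ, mul_one]
    rw [this, smul_smul, inv_mul_cancel₀ hw, one_smul]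
  have hz' : ∀ n : ℕ, κ' * iterComm v c x y n
      = v ^ (-(c + 2 * (n : ℤ))) • (iterComm v c x y n * κ') := by
    intro n
    rw [zpow_neg]
    exact inv (zpow_ne_zero _ hv) (hz n)
  have head : ∀ n : ℕ, (f * x - x * f) * iterComm v c x y n
      - v ^ (c + 2 * (n : ℤ)) • (iterComm v c x y n * (f * x - x * f))
      = -((s * (v ^ (c + 2 * (n : ℤ)) - v ^ (-(c + 2 * (n : ℤ))))) •
        (iterComm v c x y n * κ')) := by
    intro n
    rw [hx', smul_mul_assoc, sub_mul, hz, hz', mul_smul_comm, mul_sub]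
    simp only [sub_mul, smul_sub, sub_smul, smul_smul, mul_comm s]
    abel
  induction n with
  | zero =>
    rw [comm_iterComm_succ, head]
    simp [iterComm, hy.eq]
  | succ n ih =>
    rw [comm_iterComm_succ, head, ih, Finset.sum_range_succ _ (n + 1)]
    have hκx : κ' * x = v ^ (-2 : ℤ) • (x * κ') := by
      rw [zpow_neg]
      exact inv (zpow_ne_zero _ hv) h1
    have hI : iterComm v c x y (n + 1) * κ'
        = x * (iterComm v c x y n * κ')
          - v ^ (c + 2 * ((n + 1 : ℕ) : ℤ)) • (iterComm v c x y n * κ' * x) := by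
      rw [mul_assoc _ κ', hκx, mul_smul_comm, smul_smul, ← zpow_add₀ hv, iterComm, sub_mul,
        smul_mul_assoc]
      simp only [mul_assoc]
      congr 3
      push_cast
      ring
    rw [hI]
    simp only [mul_neg, neg_mul, mul_smul_comm, smul_mul_assoc, mul_add, add_smul, smul_sub,
      smul_neg, smul_smul, mul_comm, mul_left_comm]
    abel

/-- The exponents `-n, -n + 2, …, n` are symmetric about `0`. -/
lemma sum_zpow_symm (v : K) (n : ℕ) :
    ∑ l ∈ Finset.range (n + 1), (v ^ (-(n : ℤ) + 2 * l) - v ^ (-(-(n : ℤ) + 2 * l))) = 0 := by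
  rw [Finset.sum_sub_distrib, sub_eq_zero, ← Finset.sum_range_reflect]
  refine Finset.sum_congr rfl fun l hl => ?_
  rw [Finset.mem_range] at hl
  congr 1
  omega

/-- For `c = 1 - m` the coefficient of the last bracket in `comm_iterComm` is the symmetric sum
`sum_zpow_symm`, which is zero. For `m = 0` the iterated commutator is `y` itself. -/
lemma commute_serre_left {v : K} (hv : v ≠ 0) (h : ∀ n : ℤ, 0 < n → v ^ n ≠ 1) (m : ℕ)
    {x y f κ κ' : A} {s : K}
    (h1 : κ * x = v ^ (2 : ℤ) • (x * κ)) (h2 : κ * y = v ^ (1 - m : ℤ) • (y * κ))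
    (hκ : κ * κ' = 1) (hκ' : κ' * κ = 1) (hx : x * f - f * x = s • (κ - κ')) (hy : Commute f y) :
    Commute f (serre v m x y) := by
  have hm : (-1) ^ m * qFact v m ≠ 0 := mul_ne_zero (by simp) (qFact_ne_zero hv h m)
  have key : Commute f (iterComm v (1 - m) x y m) := by
    cases m with
    | zero => exact hy
    | succ n =>
      have := comm_iterComm hv _ h1 h2 hκ hκ' hx hy n
      rw [show (1 - ((n + 1 : ℕ) : ℤ)) = -n by push_cast; ring] at this ⊢
      rw [sum_zpow_symm, mul_zero, zero_smul, neg_zero, sub_eq_zero] at this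
      exact this
  rw [iterComm_eq_serre hv h] at key
  have := key.smul_right ((-1) ^ m * qFact v m)⁻¹
  rwa [smul_smul, inv_mul_cancel₀ hm, one_smul] at this

/-! ### Brackets with the generator opposite to the second argument -/

lemma iterComm_of_mul_eq {v : K} (hv : v ≠ 0) (c : ℤ) {x κ : A} (h1 : κ * x = v ^ c • (x * κ))
    (n : ℕ) : iterComm v c x κ n
      = (∏ l ∈ Finset.range n, (1 - v ^ (2 * c + 2 * l))) • (x ^ n * κ) := by
  induction n with
  | zero => simp [iterComm]
  | succ n ih =>
    rw [iterComm, ih, Finset.prod_range_succ, mul_smul_comm, smul_mul_assoc, mul_assoc (x ^ n), h1,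
      mul_smul_comm, ← mul_assoc, ← mul_assoc, ← pow_succ', ← pow_succ,
      show 2 * c + 2 * (n : ℤ) = (c + 2 * n) + c by ring, zpow_add₀ hv (c + 2 * (n : ℤ)) c]
    simp only [mul_sub, sub_smul, smul_smul, mul_one]
    congr 2
    ring

lemma iterComm_of_mul_eq_inv {v : K} (hv : v ≠ 0) (c : ℤ) {x κ : A}
    (h1 : κ * x = v ^ (-c) • (x * κ)) (n : ℕ) : iterComm v c x κ (n + 1) = 0 := by
  induction n with
  | zero =>
    simp only [iterComm, h1, smul_smul, Nat.cast_zero, mul_zero, add_zero]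
    rw [← zpow_add₀ hv]
    simp
  | succ n ih => rw [iterComm, ih]; simp

lemma iterComm_smul_sub (v : K) (c : ℤ) (s : K) (x y z : A) (n : ℕ) :
    iterComm v c x (s • (y - z)) n = s • (iterComm v c x y n - iterComm v c x z n) := by
  induction n with
  | zero => rfl
  | succ n ih =>
    rw [iterComm, ih, iterComm, iterComm]
    simp only [mul_smul_comm, smul_mul_assoc, mul_sub, sub_mul, smul_sub, smul_smul, mul_comm s]
    abel

lemma comm_iterComm_of_commute (v : K) (c : ℤ) {x f : A} (y : A) (hx : Commute f x) (n : ℕ) :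
    f * iterComm v c x y n - iterComm v c x y n * f = iterComm v c x (f * y - y * f) n := by
  induction n with
  | zero => rfl
  | succ n ih => rw [comm_iterComm_succ, hx.eq, ih, iterComm]; simp

/-- Since `f` commutes with `x`, its bracket passes to the innermost entry `y` and gives a multiple
of `κ' - κ`. The `m`-fold `q`-commutator kills both terms: `κ'` already at the first step, `κ` at
the last one. -/
lemma commute_serre_right {v : K} (hv : v ≠ 0) (h : ∀ n : ℤ, 0 < n → v ^ n ≠ 1) (m : ℕ)
    (hm0 : m ≠ 0) {x y f κ κ' : A} {s : K} (h1 : κ * x = v ^ (1 - m : ℤ) • (x * κ))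
    (h2 : κ' * x = v ^ (-(1 - m : ℤ)) • (x * κ'))
    (hy : y * f - f * y = s • (κ - κ')) (hx : Commute f x) :
    Commute f (serre v m x y) := by
  have hm : (-1) ^ m * qFact v m ≠ 0 := mul_ne_zero (by simp) (qFact_ne_zero hv h m)
  have key : Commute f (iterComm v (1 - m) x y m) := by
    obtain ⟨n, rfl⟩ := Nat.exists_eq_succ_of_ne_zero hm0
    have hy' : f * y - y * f = s • (κ' - κ) := by
      rw [← neg_sub, hy, ← smul_neg, neg_sub]
    rw [commute_iff_eq, ← sub_eq_zero, comm_iterComm_of_commute _ _ _ hx, hy', iterComm_smul_sub,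
      iterComm_of_mul_eq_inv hv _ h2, iterComm_of_mul_eq hv _ h1,
      Finset.prod_eq_zero (Finset.self_mem_range_succ n), zero_smul, sub_zero, smul_zero]
    -- The last factor, `l = m - 1`, of the product is `1 - v ^ 0`.
    rw [sub_eq_zero, eq_comm, show 2 * (1 - ((n + 1 : ℕ) : ℤ)) + 2 * n = 0 by push_cast; ring,
      zpow_zero]
  rw [iterComm_eq_serre hv h] at key
  have := key.smul_right ((-1) ^ m * qFact v m)⁻¹
  rwa [smul_smul, inv_mul_cancel₀ hm, one_smul] at this

lemma commute_serre (v : K) (m : ℕ) {x y f : A} (hx : Commute f x) (hy : Commute f y) :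
    Commute f (serre v m x y) := by
  refine Commute.sum_right _ _ _ fun l _ => ?_
  exact ((((hx.pow_right _).smul_right _).mul_right hy).mul_right
    ((hx.pow_right _).smul_right _)).smul_right _

end Commutation

variable {I X Y : Type*} [AddCommGroup X] [AddCommGroup Y] {C : CartanDatum I}

namespace RootDatum

variable (D : RootDatum C X Y)

/-- Elements of an algebra that satisfy the defining relations of the quantum group other than the
Serre relations. -/
structure PreRel {A : Type*} [Ring A] [Algebra K A] (e f : I → A) (k : Y → A) : Prop where
  k_zero : k 0 = 1
  k_mul_k : ∀ μ ν, k μ * k ν = k (μ + ν)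
  k_mul_e : ∀ μ i, k μ * e i = q ^ D.pairing μ (D.root i) • (e i * k μ)
  k_mul_f : ∀ μ i, k μ * f i = q ^ (-D.pairing μ (D.root i)) • (f i * k μ)
  e_f_same : ∀ i, e i * f i - f i * e i
    = (C.q i - (C.q i)⁻¹)⁻¹ • (k (D.h i) - k (-D.h i))
  e_f_ne : ∀ i j, i ≠ j → e i * f j - f j * e i = 0

namespace PreRel

variable {D} {A : Type*} [Ring A] [Algebra K A] {e f : I → A} {k : Y → A}

/-- Exchanging `e` with `f` and inverting `k` preserves these relations, so statements about Serre
elements in the `f_j` follow from those in the `e_j`. -/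
lemma symm (P : D.PreRel e f k) : D.PreRel f e (fun μ => k (-μ)) where
  k_zero := by simpa using P.k_zero
  k_mul_k μ ν := by rw [P.k_mul_k, neg_add]
  k_mul_e μ i := by simpa using P.k_mul_f (-μ) i
  k_mul_f μ i := by simpa using P.k_mul_e (-μ) i
  e_f_same i := by
    rw [← neg_sub, P.e_f_same, ← smul_neg, neg_sub, neg_neg]
  e_f_ne i j hij := by rw [← neg_sub, P.e_f_ne j i hij.symm, neg_zero]

lemma commute_serre_e (P : D.PreRel e f k) {i j : I} (hij : i ≠ j) (l : I) :
    Commute (f l) (serre (C.q i) (1 - D.c i j).toNat (e i) (e j)) := by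
  have hm := D.one_sub_toNat hij
  -- `commute_serre_right` needs at least one commutator; `c_{i,j} ≤ 0` provides it.
  have hm0 : (1 - D.c i j).toNat ≠ 0 := by
    intro h0
    rw [h0] at hm
    have := D.d_mul_c i j
    have h3 : C.dot i j ≤ 0 := by
      have a := C.dot_self_dvd i j hij
      have b := C.dot_nonpos i j hij
      have e := Int.mul_ediv_cancel' a
      have p := C.dot_self_pos i
      nlinarith
    have := C.d_pos i
    simp only [Nat.cast_zero, sub_zero] at hm
    have := mul_pos this (show 0 < D.c i j by omega)
    omega
  have hne : ∀ {i}, l ≠ i → Commute (f l) (e i) := fun {i} h =>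
    (sub_eq_zero.1 (P.e_f_ne i l h.symm)).symm
  by_cases hi : l = i
  · subst hi
    refine commute_serre_left (C.q_ne_zero l) (C.q_generic l) _ (κ := k (D.h l))
      (κ' := k (-D.h l)) ?_ ?_ ?_ ?_ (P.e_f_same l) (hne hij)
    · rw [P.k_mul_e, pairing_h, q_zpow_two]
    · rw [P.k_mul_e, pairing_h, hm, q_zpow_c]
    · rw [P.k_mul_k, add_neg_cancel, P.k_zero]
    · rw [P.k_mul_k, neg_add_cancel, P.k_zero]
  by_cases hj : l = j
  · subst hj
    refine commute_serre_right (C.q_ne_zero i) (C.q_generic i) _ hm0 (κ := k (D.h l))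
      (κ' := k (-D.h l)) ?_ ?_ (P.e_f_same l) (hne hi)
    · rw [P.k_mul_e, pairing_h, hm, q_zpow_c, C.dot_comm]
    · rw [P.k_mul_e, map_neg, LinearMap.neg_apply, pairing_h, hm, zpow_neg, zpow_neg, q_zpow_c,
        C.dot_comm]
  · exact commute_serre _ _ (hne hi) (hne hj)

lemma commute_serre_f (P : D.PreRel e f k) {i j : I} (hij : i ≠ j) (l : I) :
    Commute (e l) (serre (C.q i) (1 - D.c i j).toNat (f i) (f j)) :=
  P.symm.commute_serre_e hij l

end PreRel

/-! ### Highest weight modules -/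

section Verma

open Finsupp

/-- The action of `k_μ` on the module with basis the words in the `f_j`, of highest weight `lam`. -/
noncomputable def vermaK (lam : X) (μ : Y) : Module.End K (List I →₀ K) :=
  linearCombination K fun w => q ^ D.pairing μ (lam - (w.map D.root).sum) • single w (1 : K)

/-- The action of `f_j` on words. -/
noncomputable def vermaF (j : I) : Module.End K (List I →₀ K) :=
  linearCombination K fun w => single (j :: w) (1 : K)

open Classical in
/-- The vector `e_j w` for a word `w`. -/
noncomputable def vermaEWord (lam : X) (j : I) : List I → (List I →₀ K)
  | [] => 0
  | l :: w => vermaF l (vermaEWord lam j w) +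
      if j = l then (C.q j - (C.q j)⁻¹)⁻¹ •
        (D.vermaK lam (D.h j) (single w 1) - D.vermaK lam (-D.h j) (single w 1)) else 0

/-- The action of `e_j` on words. -/
noncomputable def vermaE (lam : X) (j : I) : Module.End K (List I →₀ K) :=
  linearCombination K (D.vermaEWord lam j)

lemma vermaK_single (lam : X) (μ : Y) (w : List I) : D.vermaK lam μ (single w 1)
    = q ^ D.pairing μ (lam - (w.map D.root).sum) • single w (1 : K) := by
  rw [vermaK, linearCombination_single, one_smul]

lemma vermaF_single (j : I) (w : List I) : vermaF j (single w 1) = single (j :: w) (1 : K) := by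
  rw [vermaF, linearCombination_single, one_smul]

lemma vermaE_single (lam : X) (j : I) (w : List I) :
    D.vermaE lam j (single w 1) = D.vermaEWord lam j w := by
  rw [vermaE, linearCombination_single, one_smul]

lemma end_ext {V : Type*} [AddCommGroup V] [Module K V] {φ ψ : (List I →₀ K) →ₗ[K] V}
    (h : ∀ w, φ (single w 1) = ψ (single w 1)) : φ = ψ :=
  Finsupp.lhom_ext' fun w => LinearMap.ext_ring (h w)

lemma vermaK_mul_vermaF (lam : X) (μ : Y) (i : I) : D.vermaK lam μ * vermaF i
    = q ^ (-D.pairing μ (D.root i)) • (vermaF i * D.vermaK lam μ) := by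
  refine end_ext fun w => ?_
  rw [LinearMap.smul_apply, Module.End.mul_apply, Module.End.mul_apply, vermaF_single,
    vermaK_single, vermaK_single, map_smul, vermaF_single, smul_smul, ← zpow_add₀ q_ne_zero]
  congr 2
  simp only [List.map_cons, List.sum_cons, map_sub, map_add]
  ring

lemma vermaK_mul_vermaK (lam : X) (μ ν : Y) :
    D.vermaK lam μ * D.vermaK lam ν = D.vermaK lam (μ + ν) := by
  refine end_ext fun w => ?_
  rw [Module.End.mul_apply, vermaK_single, map_smul, vermaK_single, vermaK_single, smul_smul,
    ← zpow_add₀ q_ne_zero, map_add, LinearMap.add_apply, add_comm]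

lemma vermaK_zero (lam : X) : D.vermaK lam 0 = 1 := by
  refine end_ext fun w => ?_
  rw [vermaK_single]
  simp

/-- The operator `e_i` raises weights by the root of `i`. The recursion defining it does not mention
weights, so this needs its own induction; it is what gives the relation between `k_μ` and `e_i`. -/
lemma vermaK_vermaEWord (lam : X) (μ : Y) (i : I) (w : List I) :
    D.vermaK lam μ (D.vermaEWord lam i w)
      = q ^ D.pairing μ (lam + D.root i - (w.map D.root).sum) • D.vermaEWord lam i w := by
  induction w with
  | nil => simp [vermaEWord]
  | cons l w ih =>
    rw [vermaEWord, map_add, ← Module.End.mul_apply, vermaK_mul_vermaF, LinearMap.smul_apply,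
      Module.End.mul_apply, ih, map_smul, smul_smul, ← zpow_add₀ q_ne_zero, smul_add]
    congr 1
    · congr 2
      simp only [List.map_cons, List.sum_cons, map_sub, map_add]
      ring
    · split_ifs with h
      · subst h
        rw [map_smul, map_sub, smul_comm (q ^ _), smul_sub]
        simp only [vermaK_single, map_smul]
        have : D.pairing μ (lam + D.root i - (List.map D.root (i :: w)).sum)
            = D.pairing μ (lam - (w.map D.root).sum) := by
          simp only [List.map_cons, List.sum_cons, map_sub, map_add]
          ring
        rw [this]
        simp only [smul_sub, smul_smul, mul_comm]
      · simp

/-- The commutators of `e_i` with `f_j` hold by construction, since the recursion for `e_i` on `j ::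
w` is this relation solved for `e_i f_j`. -/
lemma verma_preRel (lam : X) : D.PreRel (D.vermaE lam) vermaF (D.vermaK lam) where
  k_zero := D.vermaK_zero lam
  k_mul_k := D.vermaK_mul_vermaK lam
  k_mul_f := D.vermaK_mul_vermaF lam
  k_mul_e μ i := by
    refine end_ext fun w => ?_
    rw [LinearMap.smul_apply, Module.End.mul_apply, Module.End.mul_apply, vermaE_single,
      vermaK_vermaEWord, vermaK_single, map_smul, vermaE_single, smul_smul, ← zpow_add₀ q_ne_zero]
    congr 2
    simp only [map_sub, map_add]
    ring
  e_f_same i := by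
    refine end_ext fun w => ?_
    simp only [LinearMap.sub_apply, LinearMap.smul_apply, Module.End.mul_apply, vermaF_single,
      vermaE_single, vermaEWord, if_true, add_sub_cancel_left]
  e_f_ne i j hij := by
    refine end_ext fun w => ?_
    simp only [LinearMap.sub_apply, Module.End.mul_apply, vermaF_single, LinearMap.zero_apply,
      vermaE_single, vermaEWord, if_neg hij, add_zero, sub_self]

/-- The vectors from which no word in the `e_j` leads to a nonzero multiple of the highest weight
vector. -/
noncomputable def vermaRadical (lam : X) : Submodule K (List I →₀ K) :=
  ⨅ w : List I, LinearMap.ker (lapply [] ∘ₗ (w.map (D.vermaE lam)).prod)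

lemma mem_vermaRadical {lam : X} {x : List I →₀ K} :
    x ∈ D.vermaRadical lam ↔ ∀ w : List I, (w.map (D.vermaE lam)).prod x [] = 0 := by
  simp [vermaRadical]

/-! ### Stability of the radical under the generators -/

lemma vermaF_apply_nil (j : I) (x : List I →₀ K) : vermaF j x [] = 0 := by
  have : lapply [] ∘ₗ vermaF j = (0 : (List I →₀ K) →ₗ[K] K) :=
    end_ext fun w => by simp [vermaF_single]
  exact LinearMap.congr_fun this x

lemma vermaK_apply_nil (lam : X) (μ : Y) (x : List I →₀ K) :
    D.vermaK lam μ x [] = q ^ D.pairing μ lam * x [] := by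
  have : lapply [] ∘ₗ D.vermaK lam μ = q ^ D.pairing μ lam • (lapply [] : (List I →₀ K) →ₗ[K] K) :=
    end_ext fun w => by
      cases w <;> simp [vermaK_single]
  exact LinearMap.congr_fun this x

lemma vermaE_mem {lam : X} (j : I) {x : List I →₀ K} (hx : x ∈ D.vermaRadical lam) :
    D.vermaE lam j x ∈ D.vermaRadical lam := by
  rw [mem_vermaRadical] at hx ⊢
  intro w
  simpa using hx (w ++ [j])

lemma vermaK_mem {lam : X} (μ : Y) {x : List I →₀ K} (hx : x ∈ D.vermaRadical lam) :
    D.vermaK lam μ x ∈ D.vermaRadical lam := by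
  rw [mem_vermaRadical] at hx ⊢
  intro w
  have : ∃ s : K, (w.map (D.vermaE lam)).prod * D.vermaK lam μ
      = s • (D.vermaK lam μ * (w.map (D.vermaE lam)).prod) := by
    induction w with
    | nil => exact ⟨1, by simp⟩
    | cons l w ih =>
      obtain ⟨s, hs⟩ := ih
      refine ⟨s * (q ^ D.pairing μ (D.root l))⁻¹, ?_⟩
      rw [List.map_cons, List.prod_cons, mul_assoc, hs, mul_smul_comm, ← mul_assoc,
        swap_smul (A := Module.End K (List I →₀ K)) (zpow_ne_zero _ q_ne_zero)
          ((D.verma_preRel lam).k_mul_e μ l), smul_mul_assoc,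
        smul_smul, mul_assoc]
  obtain ⟨s, hs⟩ := this
  rw [← Module.End.mul_apply, hs, LinearMap.smul_apply, Module.End.mul_apply, Finsupp.smul_apply,
    vermaK_apply_nil, hx, mul_zero, smul_zero]

/-- The operator `f_j` is moved to the left through a word in the `e_l`. Each commutator is a
combination of `k`'s, which preserve the radical; once `f_j` is outermost, its image has no
component at the empty word. The induction peels off the last letter because that is the one next to
`f_j`. -/
lemma vermaF_mem {lam : X} (j : I) {x : List I →₀ K} (hx : x ∈ D.vermaRadical lam) :
    vermaF j x ∈ D.vermaRadical lam := by
  rw [mem_vermaRadical]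
  intro w
  induction w using List.reverseRecOn generalizing x with
  | nil => exact vermaF_apply_nil j x
  | append_singleton w l ih =>
    have h1 : D.vermaE lam l (vermaF j x) - vermaF j (D.vermaE lam l x) ∈ D.vermaRadical lam := by
      have hP := D.verma_preRel lam
      by_cases h : l = j
      · subst h
        have := LinearMap.congr_fun (hP.e_f_same l) x
        simp only [LinearMap.sub_apply, Module.End.mul_apply] at this
        rw [this]
        exact Submodule.smul_mem _ _ (sub_mem (D.vermaK_mem _ hx) (D.vermaK_mem _ hx))
      · have := LinearMap.congr_fun (hP.e_f_ne l j h) x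
        simp only [LinearMap.sub_apply, Module.End.mul_apply] at this
        rw [this]
        exact zero_mem _
    have h2 := (D.mem_vermaRadical.1 h1) w
    rw [map_sub, Finsupp.sub_apply, ih (D.vermaE_mem l hx), sub_zero] at h2
    simpa using h2

/-- The Serre element commutes with every `e_l`, so a word in the `e_l` can be applied before it.
Each of its summands ends by applying some `f`, hence has no component at the empty word. -/
lemma serre_vermaF_mem (lam : X) {i j : I} (hij : i ≠ j) (x : List I →₀ K) :
    serre (C.q i) (1 - D.c i j).toNat (vermaF i) (vermaF j) x ∈ D.vermaRadical lam := by
  rw [mem_vermaRadical]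
  intro w
  set S := serre (C.q i) (1 - D.c i j).toNat (vermaF i) (vermaF j)
  have h1 : Commute (w.map (D.vermaE lam)).prod S := by
    refine Commute.list_prod_left _ _ fun a ha => ?_
    obtain ⟨l, -, rfl⟩ := List.mem_map.1 ha
    exact (D.verma_preRel lam).commute_serre_f hij l
  have h2 : ∀ y, S y [] = 0 := by
    intro y
    have hF : ∀ (n : ℕ) (z : List I →₀ K), (vermaF i ^ n) (vermaF j z) [] = 0 := by
      intro n z
      cases n with
      | zero => exact vermaF_apply_nil _ _
      | succ n =>
        rw [pow_succ', Module.End.mul_apply]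
        exact vermaF_apply_nil _ _
    simp only [S, serre, divPow, LinearMap.sum_apply, LinearMap.smul_apply, Finsupp.finsetSum_apply,
      Finsupp.smul_apply, Module.End.mul_apply, map_smul, hF, smul_zero, Finset.sum_const_zero]
  rw [← Module.End.mul_apply, h1.eq, Module.End.mul_apply, h2]

/-- This holds before dividing by the radical: the Serre element commutes with all `f_l` and kills
the empty word, from which the `f_l` generate everything. -/
lemma serre_vermaE_eq_zero (lam : X) {i j : I} (hij : i ≠ j) :
    serre (C.q i) (1 - D.c i j).toNat (D.vermaE lam i) (D.vermaE lam j) = 0 := by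
  refine end_ext fun w => ?_
  rw [LinearMap.zero_apply]
  induction w with
  | nil =>
    have hE : ∀ l : I, D.vermaE lam l (single [] 1) = 0 := fun l => by
      rw [vermaE_single, vermaEWord]
    have hE' : ∀ (n : ℕ), n ≠ 0 → (D.vermaE lam i ^ n) (single [] 1) = 0 := by
      intro n hn
      obtain ⟨n, rfl⟩ := Nat.exists_eq_succ_of_ne_zero hn
      rw [pow_succ, Module.End.mul_apply, hE, map_zero]
    simp only [serre, divPow, LinearMap.sum_apply, LinearMap.smul_apply, Module.End.mul_apply]
    refine Finset.sum_eq_zero fun l _ => ?_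
    -- The operator acting first is `e_i` if the right-hand exponent is positive, and `e_j`
    -- otherwise; either one kills the empty word.
    by_cases h : (1 - D.c i j).toNat - l = 0
    · rw [h, pow_zero, Module.End.one_apply, map_smul, hE]; simp
    · rw [hE' _ h]; simp
  | cons l w ih =>
    rw [← vermaF_single, ← Module.End.mul_apply,
      ← ((D.verma_preRel lam).commute_serre_e hij l).eq, Module.End.mul_apply, ih, map_zero]

/-- The action of the generators on words. -/
noncomputable def vermaGen (lam : X) : Gen I Y → Module.End K (List I →₀ K)
  | .e i => D.vermaE lam i
  | .f i => vermaF i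
  | .k μ => D.vermaK lam μ

lemma vermaGen_mem (lam : X) (g : Gen I Y) :
    D.vermaRadical lam ≤ (D.vermaRadical lam).comap (D.vermaGen lam g) := by
  intro x hx
  cases g with
  | e i => exact D.vermaE_mem i hx
  | f i => exact D.vermaF_mem i hx
  | k μ => exact D.vermaK_mem μ hx

/-- The action of the generators on the quotient of the space of words by the radical. -/
noncomputable def simpleGen (lam : X) (g : Gen I Y) :
    Module.End K ((List I →₀ K) ⧸ D.vermaRadical lam) :=
  (D.vermaRadical lam).mapQ (D.vermaRadical lam) (D.vermaGen lam g) (D.vermaGen_mem lam g)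

lemma lift_simpleGen_mk (lam : X) (a : FreeAlgebra K (Gen I Y)) (x : List I →₀ K) :
    FreeAlgebra.lift K (D.simpleGen lam) a ((D.vermaRadical lam).mkQ x)
      = (D.vermaRadical lam).mkQ (FreeAlgebra.lift K (D.vermaGen lam) a x) := by
  induction a using FreeAlgebra.induction generalizing x with
  | grade0 r => simp [Module.algebraMap_end_apply]
  | grade1 g => simp only [FreeAlgebra.lift_ι_apply, simpleGen, Submodule.mkQ_apply,
      Submodule.mapQ_apply]
  | mul a b ha hb => rw [map_mul, map_mul, Module.End.mul_apply, hb, ha, Module.End.mul_apply]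
  | add a b ha hb => rw [map_add, map_add, LinearMap.add_apply, ha, hb, LinearMap.add_apply, map_add]

lemma lift_vermaGen_sub_mem (lam : X) {a b : FreeAlgebra K (Gen I Y)} (hab : Rel D a b)
    (x : List I →₀ K) : FreeAlgebra.lift K (D.vermaGen lam) a x
      - FreeAlgebra.lift K (D.vermaGen lam) b x ∈ D.vermaRadical lam := by
  have hP := D.verma_preRel lam
  have of_eq : FreeAlgebra.lift K (D.vermaGen lam) a = FreeAlgebra.lift K (D.vermaGen lam) b →
      FreeAlgebra.lift K (D.vermaGen lam) a x
      - FreeAlgebra.lift K (D.vermaGen lam) b x ∈ D.vermaRadical lam := by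
    intro h
    rw [h, sub_self]
    exact zero_mem _
  cases hab with
  | k_zero =>
    apply of_eq
    rw [FreeAlgebra.lift_ι_apply, map_one]
    exact hP.k_zero
  | k_add μ ν =>
    apply of_eq
    rw [map_mul]
    simp only [FreeAlgebra.lift_ι_apply]
    exact hP.k_mul_k μ ν
  | k_e μ i =>
    apply of_eq
    simp only [map_mul, map_smul, FreeAlgebra.lift_ι_apply]
    exact hP.k_mul_e μ i
  | k_f μ i =>
    apply of_eq
    simp only [map_mul, map_smul, FreeAlgebra.lift_ι_apply]
    exact hP.k_mul_f μ i
  | e_f_same i =>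
    apply of_eq
    simp only [map_mul, map_smul, map_sub, FreeAlgebra.lift_ι_apply]
    exact hP.e_f_same i
  | e_f_ne i j hij =>
    apply of_eq
    simp only [map_mul, map_sub, map_zero, FreeAlgebra.lift_ι_apply]
    exact hP.e_f_ne i j hij
  | serre_e i j hij =>
    apply of_eq
    rw [map_serre (FreeAlgebra.lift K (D.vermaGen lam)), map_zero, FreeAlgebra.lift_ι_apply,
      FreeAlgebra.lift_ι_apply]
    exact D.serre_vermaE_eq_zero lam hij
  | serre_f i j hij =>
    rw [map_serre (FreeAlgebra.lift K (D.vermaGen lam)), map_zero, FreeAlgebra.lift_ι_apply,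
      FreeAlgebra.lift_ι_apply, LinearMap.zero_apply, sub_zero]
    exact D.serre_vermaF_mem lam hij x

lemma simpleGen_rel (lam : X) ⦃a b : FreeAlgebra K (Gen I Y)⦄ (hab : Rel D a b) :
    FreeAlgebra.lift K (D.simpleGen lam) a = FreeAlgebra.lift K (D.simpleGen lam) b := by
  refine LinearMap.ext fun x => ?_
  obtain ⟨x, rfl⟩ := Submodule.mkQ_surjective _ x
  rw [lift_simpleGen_mk, lift_simpleGen_mk, ← sub_eq_zero, ← map_sub, Submodule.mkQ_apply,
    Submodule.Quotient.mk_eq_zero]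
  exact D.lift_vermaGen_sub_mem lam hab x

/-- The simple highest weight representation. -/
noncomputable def simpleRep (lam : X) :
    D.U →ₐ[K] Module.End K ((List I →₀ K) ⧸ D.vermaRadical lam) :=
  D.liftHom (D.simpleGen lam) (D.simpleGen_rel lam)

lemma liftHom_proj {A : Type*} [Ring A] [Algebra K A] (φ : Gen I Y → A)
    (hφ : ∀ ⦃a b⦄, Rel D a b → FreeAlgebra.lift K φ a = FreeAlgebra.lift K φ b) (g : Gen I Y) :
    D.liftHom φ hφ (D.proj (FreeAlgebra.ι K g)) = φ g :=
  (RingQuot.liftAlgHom_mkAlgHom_apply K _ _ _).trans (FreeAlgebra.lift_ι_apply _ _)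

/-- The highest weight vector. -/
noncomputable def highestVec (lam : X) : (List I →₀ K) ⧸ D.vermaRadical lam :=
  (D.vermaRadical lam).mkQ (single [] 1)

lemma highestVec_ne_zero (lam : X) : D.highestVec lam ≠ 0 := by
  intro h
  have h1 : single [] 1 ∈ D.vermaRadical lam := by simpa [highestVec] using h
  have := D.mem_vermaRadical.1 h1 []
  simp at this

lemma simpleRep_e_highestVec (lam : X) (j : I) :
    D.simpleRep lam (D.e j) (D.highestVec lam) = 0 := by
  rw [simpleRep, e, liftHom_proj, simpleGen, highestVec, Submodule.mkQ_apply, Submodule.mapQ_apply,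
    vermaGen, vermaE_single, vermaEWord, Submodule.Quotient.mk_zero]

lemma simpleRep_k_highestVec (lam : X) (μ : Y) :
    D.simpleRep lam (D.k μ) (D.highestVec lam) = q ^ D.pairing μ lam • D.highestVec lam := by
  rw [simpleRep, k, liftHom_proj, simpleGen, highestVec, Submodule.mkQ_apply, Submodule.mapQ_apply,
    vermaGen, vermaK_single, Submodule.Quotient.mk_smul, List.map_nil, List.sum_nil, sub_zero]

end Verma

/-! ### The intersection of `U⁺` and `U⁺ k_i²` -/

lemma comul_e (i : I) : D.comul (D.e i) = D.e i ⊗ₜ 1 + D.k (D.h i) ⊗ₜ D.e i :=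
  D.liftHom_proj _ _ _

lemma comul_f (i : I) : D.comul (D.f i) = D.f i ⊗ₜ D.k (-D.h i) + 1 ⊗ₜ D.f i :=
  D.liftHom_proj _ _ _

lemma comul_k (μ : Y) : D.comul (D.k μ) = D.k μ ⊗ₜ D.k μ :=
  D.liftHom_proj _ _ _

lemma antipode_e (i : I) : D.antipode (D.e i) = MulOpposite.op (-(D.k (-D.h i) * D.e i)) :=
  D.liftHom_proj _ _ _

lemma antipode_f (i : I) : D.antipode (D.f i) = MulOpposite.op (-(D.f i * D.k (D.h i))) :=
  D.liftHom_proj _ _ _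

lemma antipode_k (μ : Y) : D.antipode (D.k μ) = MulOpposite.op (D.k (-μ)) :=
  D.liftHom_proj _ _ _

/-- The tensor product of a simple highest weight representation with the left regular
representation. -/
noncomputable def tensorRep (lam : X) :
    D.U →ₐ[K] Module.End K (((List I →₀ K) ⧸ D.vermaRadical lam) ⊗[K] D.U) :=
  (Module.endTensorEndAlgHom (R := K) (S := K) (A := K)).comp
    ((Algebra.TensorProduct.map (D.simpleRep lam) (Algebra.lmul K D.U)).comp D.comul)

lemma k_neg_mul_k (μ : Y) : D.k (-μ) * D.k μ = 1 := by
  rw [k_mul_k, neg_add_cancel, k_zero]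

lemma k_mul_k_neg (μ : Y) : D.k μ * D.k (-μ) = 1 := by
  rw [k_mul_k, add_neg_cancel, k_zero]

/-- In `Δ(e_j)` the term `e_j ⊗ 1` kills the highest weight vector, so only `k_j ⊗ e_j` acts. -/
lemma tensorRep_e (lam : X) (j : I) (y : D.U) :
    D.tensorRep lam (D.e j) (D.highestVec lam ⊗ₜ y)
      = D.highestVec lam ⊗ₜ (q ^ D.pairing (D.h j) lam • (D.e j * y)) := by
  simp only [tensorRep, AlgHom.comp_apply, comul_e, map_add, Algebra.TensorProduct.map_tmul,
    Module.endTensorEndAlgHom_apply, LinearMap.add_apply, TensorProduct.AlgebraTensorModule.map_tmul,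
    simpleRep_e_highestVec, simpleRep_k_highestVec, TensorProduct.zero_tmul, zero_add,
    TensorProduct.smul_tmul, Algebra.coe_lmul_eq_mul, LinearMap.mul_apply']

lemma tensorRep_k (lam : X) (μ : Y) (y : D.U) :
    D.tensorRep lam (D.k μ) (D.highestVec lam ⊗ₜ y)
      = D.highestVec lam ⊗ₜ (q ^ D.pairing μ lam • (D.k μ * y)) := by
  simp only [tensorRep, AlgHom.comp_apply, comul_k, Algebra.TensorProduct.map_tmul,
    Module.endTensorEndAlgHom_apply, TensorProduct.AlgebraTensorModule.map_tmul,
    simpleRep_k_highestVec, TensorProduct.smul_tmul, Algebra.coe_lmul_eq_mul, LinearMap.mul_apply']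

/-- The highest weight is chosen to be the root of `i`: the scalar `q^(j·i)` produced by `e_j` is
then the one by which conjugation by `k_i` rescales `e_j`. Conjugation is multiplicative, so the
formula extends from the `e_j` to `U⁺`. -/
lemma tensorRep_uPlus (i : I) {u : D.U} (hu : u ∈ D.UPlus) (y : D.U) :
    D.tensorRep (D.root i) u (D.highestVec (D.root i) ⊗ₜ y)
      = D.highestVec (D.root i) ⊗ₜ (D.k (D.h i) * u * D.k (-D.h i) * y) := by
  induction hu using Algebra.adjoin_induction generalizing y with
  | mem x hx =>
    obtain ⟨j, rfl⟩ := hx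
    rw [tensorRep_e, k_mul_e, smul_mul_assoc, mul_assoc (D.e j), k_mul_k_neg, mul_one,
      smul_mul_assoc, pairing_h, pairing_h, C.dot_comm]
  | algebraMap r =>
    rw [AlgHom.commutes, Module.algebraMap_end_apply, ← Algebra.commutes, mul_assoc (algebraMap _ _ r),
      k_mul_k_neg, mul_one, ← Algebra.smul_def, TensorProduct.tmul_smul]
  | add a b _ _ ha hb =>
    rw [map_add, LinearMap.add_apply, ha, hb, ← TensorProduct.tmul_add, mul_add, add_mul, add_mul]
  | mul a b _ _ ha hb =>
    rw [map_mul, Module.End.mul_apply, hb, ha]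
    congr 1
    calc _ = D.k (D.h i) * a * (D.k (-D.h i) * D.k (D.h i)) * b * D.k (-D.h i) * y := by
          simp only [mul_assoc]
      _ = _ := by rw [k_neg_mul_k, mul_one, mul_assoc (D.k _) a b]

lemma eq_zero_of_tmul_eq_zero {V W : Type*} [AddCommGroup V] [Module K V] [AddCommGroup W]
    [Module K W] {m : V} (hm : m ≠ 0) {y : W} (h : m ⊗ₜ[K] y = 0) : y = 0 := by
  by_contra hy
  refine hm ((Module.forall_dual_apply_eq_zero_iff K m).1 fun g => ?_)
  have := congrArg (TensorProduct.lid K W ∘ g.rTensor W) h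
  simpa [hy] using this

/-- The action of `u k_i²` on `v ⊗ 1` is computed in two ways, as that of an element of `U⁺` and as
a product. The results differ by the scalar `q^(2 i·i)`, which is not `1`, so `k_i u k_i = 0`. -/
lemma eq_zero_of_mul_k_mem (i : I) {u : D.U} (hu : u ∈ D.UPlus)
    (hu' : u * D.k (D.h i + D.h i) ∈ D.UPlus) : u = 0 := by
  have h1 := D.tensorRep_uPlus i hu' 1
  rw [map_mul, Module.End.mul_apply, tensorRep_k, tensorRep_uPlus D i hu, ← sub_eq_zero,
    ← TensorProduct.tmul_sub] at h1
  have h2 := eq_zero_of_tmul_eq_zero (D.highestVec_ne_zero _) h1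
  have h3 : (q ^ D.pairing (D.h i + D.h i) (D.root i) - 1) • (D.k (D.h i) * u * D.k (D.h i)) = 0 := by
    rw [← h2, sub_smul, one_smul, mul_one, mul_one, mul_smul_comm, mul_assoc _ (D.k (-D.h i)),
      k_mul_k, neg_add_cancel_left, ← mul_assoc (D.k (D.h i)), mul_assoc _ (D.k (D.h i + D.h i)),
      k_mul_k, add_neg_cancel_right]
  have hq : q ^ D.pairing (D.h i + D.h i) (D.root i) - 1 ≠ 0 := by
    rw [sub_ne_zero, map_add, LinearMap.add_apply, pairing_h]
    exact q_zpow_ne_one (by have := C.dot_self_pos i; omega)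
  have h4 := (smul_eq_zero_iff_right hq).1 h3
  calc u = D.k (-D.h i) * (D.k (D.h i) * u * D.k (D.h i)) * D.k (-D.h i) := by
        rw [mul_assoc (D.k (D.h i)), ← mul_assoc, k_neg_mul_k, one_mul, mul_assoc, k_mul_k_neg,
          mul_one]
    _ = 0 := by rw [h4, mul_zero, zero_mul]

/-! ### The adjoint action of the generators -/

lemma ad_e_apply (i : I) (y : D.U) :
    D.ad (D.e i) y = D.e i * y - D.k (D.h i) * y * D.k (-D.h i) * D.e i := by
  simp [ad, comul_e, antipode_e, sub_eq_add_neg, mul_assoc]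

lemma ad_k_apply (μ : Y) (y : D.U) : D.ad (D.k μ) y = D.k μ * y * D.k (-μ) := by
  simp [ad, comul_k, antipode_k]

lemma ad_f_apply (i : I) (y : D.U) :
    D.ad (D.f i) y = (D.f i * y - y * D.f i) * D.k (D.h i) := by
  simp [ad, comul_f, antipode_f, antipode_k, sub_eq_add_neg, mul_assoc, add_mul]

lemma ad_k_mul (μ : Y) (x y : D.U) :
    D.ad (D.k μ) (x * y) = D.ad (D.k μ) x * D.ad (D.k μ) y := by
  simp only [ad_k_apply]
  calc D.k μ * (x * y) * D.k (-μ) = D.k μ * x * 1 * y * D.k (-μ) := by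
        simp only [mul_assoc, one_mul]
    _ = _ := by rw [← D.k_neg_mul_k μ]; simp only [mul_assoc]

/-- The skew Leibniz rule dictated by `Δ(e_i)`. With its counterpart for `f_i` it allows stability
and local nilpotency to be checked on generators. -/
lemma ad_e_mul (i : I) (x y : D.U) : D.ad (D.e i) (x * y)
    = D.ad (D.e i) x * y + D.ad (D.k (D.h i)) x * D.ad (D.e i) y := by
  have h1 : D.ad (D.e i) (x * y) = D.e i * (x * y) - D.ad (D.k (D.h i)) (x * y) * D.e i := by
    rw [ad_e_apply, ad_k_apply]
  rw [h1, ad_k_mul, ad_e_apply, ad_e_apply, ad_k_apply, ad_k_apply]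
  simp only [mul_sub, sub_mul, mul_assoc]
  abel

lemma ad_f_mul (i : I) (x y : D.U) : D.ad (D.f i) (x * y)
    = D.ad (D.f i) x * D.ad (D.k (-D.h i)) y + x * D.ad (D.f i) y := by
  simp only [ad_f_apply, ad_k_apply, neg_neg]
  have : (D.f i * x - x * D.f i) * D.k (D.h i) * (D.k (-D.h i) * y * D.k (D.h i))
      = (D.f i * x - x * D.f i) * (D.k (D.h i) * D.k (-D.h i)) * y * D.k (D.h i) := by
    simp only [mul_assoc]
  rw [this, k_mul_k_neg]
  simp only [mul_sub, sub_mul, mul_assoc, one_mul]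
  abel

lemma ad_k_one (μ : Y) : D.ad (D.k μ) 1 = 1 := by
  rw [ad_k_apply, mul_one, k_mul_k_neg]

lemma ad_e_one (i : I) : D.ad (D.e i) 1 = 0 := by
  rw [ad_e_apply, mul_one, mul_one, k_mul_k_neg, one_mul, sub_self]

lemma ad_f_one (i : I) : D.ad (D.f i) 1 = 0 := by
  rw [ad_f_apply, mul_one, one_mul, sub_self, zero_mul]

lemma ad_k_e (μ : Y) (j : I) : D.ad (D.k μ) (D.e j) = q ^ D.pairing μ (D.root j) • D.e j := by
  rw [ad_k_apply, k_mul_e, smul_mul_assoc, mul_assoc, k_mul_k_neg, mul_one]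

lemma ad_f_e_of_ne {i j : I} (hij : j ≠ i) : D.ad (D.f i) (D.e j) = 0 := by
  rw [ad_f_apply, ← neg_sub, e_f_ne D hij, neg_zero, zero_mul]

lemma ad_k_pow (μ : Y) (j : I) (n : ℕ) :
    D.ad (D.k μ) (D.e j ^ n) = q ^ (n * D.pairing μ (D.root j)) • D.e j ^ n := by
  induction n with
  | zero => simp [ad_k_one]
  | succ n ih =>
    rw [pow_succ, ad_k_mul, ih, ad_k_e, smul_mul_smul_comm, ← zpow_add₀ q_ne_zero]
    congr 2
    push_cast
    ring

lemma k_mul_pow (μ : Y) (j : I) (n : ℕ) :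
    D.k μ * D.e j ^ n = q ^ (n * D.pairing μ (D.root j)) • (D.e j ^ n * D.k μ) := by
  rw [← smul_mul_assoc, ← ad_k_pow, ad_k_apply, mul_assoc _ _ (D.k μ), k_neg_mul_k, mul_one]

/-- The elements `ad_{e_i}^n (e_j)`. -/
noncomputable def adPow (i j : I) (n : ℕ) : D.U := (D.ad (D.e i) ^ n) (D.e j)

/-! ### The strings `ad_{e_i}^n (e_j)` -/

lemma adPow_succ (i j : I) (n : ℕ) : D.adPow i j (n + 1) = D.ad (D.e i) (D.adPow i j n) := by
  rw [adPow, pow_succ', Module.End.mul_apply, adPow]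

lemma ad_k_adPow (μ : Y) (i j : I) (n : ℕ) : D.ad (D.k μ) (D.adPow i j n)
    = q ^ (D.pairing μ (D.root j) + n * D.pairing μ (D.root i)) • D.adPow i j n := by
  induction n with
  | zero => simp [adPow, ad_k_e]
  | succ n ih =>
    rw [adPow_succ, ← Module.End.mul_apply, ← map_mul, k_mul_e, map_smul, map_mul,
      LinearMap.smul_apply, Module.End.mul_apply, ih, map_smul, smul_smul, ← zpow_add₀ q_ne_zero]
    congr 2
    push_cast
    ring

/-- Conjugation by `k_i` multiplies the `n`-th element of the string by `q_i^(c_{i,j} + 2n)`, which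
is the scalar in the `n`-th `q`-commutator. -/
lemma adPow_eq_iterComm (i j : I) (n : ℕ) :
    D.adPow i j n = iterComm (C.q i) (D.c i j) (D.e i) (D.e j) n := by
  induction n with
  | zero => rfl
  | succ n ih =>
    rw [adPow_succ, ad_e_apply, ← ad_k_apply, ad_k_adPow, pairing_h, pairing_h, iterComm, ← ih,
      smul_mul_assoc, CartanDatum.q, ← zpow_mul, mul_add, d_mul_c, ← C.two_d i]
    congr 3
    ring

lemma adPow_eq_zero {i j : I} (hij : i ≠ j) : D.adPow i j (1 - D.c i j).toNat = 0 := by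
  have := (serre_eq_zero_iff (C.q_ne_zero i) (C.q_generic i) _ _ _).1 (D.serre_e hij)
  rwa [D.one_sub_toNat hij, ← adPow_eq_iterComm] at this

/-- As for `sl₂`: `f_i` is commuted past `e_i` and acts on the lowest weight vector `e_j` by zero.
The value of the scalar plays no role. -/
lemma ad_f_adPow {i j : I} (hij : j ≠ i) (n : ℕ) :
    ∃ s : K, D.ad (D.f i) (D.adPow i j (n + 1)) = s • D.adPow i j n := by
  have step : ∀ n, D.ad (D.f i) (D.adPow i j (n + 1)) = D.ad (D.e i) (D.ad (D.f i) (D.adPow i j n))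
      - (C.q i - (C.q i)⁻¹)⁻¹ • (D.ad (D.k (D.h i)) (D.adPow i j n)
        - D.ad (D.k (-D.h i)) (D.adPow i j n)) := by
    intro n
    have h1 : D.f i * D.e i = D.e i * D.f i
        - (C.q i - (C.q i)⁻¹)⁻¹ • (D.k (D.h i) - D.k (-D.h i)) := by
      rw [← e_f_same]; abel
    rw [adPow_succ, ← Module.End.mul_apply, ← map_mul, h1]
    simp only [map_sub, map_mul, map_smul, LinearMap.sub_apply, LinearMap.smul_apply,
      Module.End.mul_apply]
  induction n with
  | zero =>
    rw [step, ad_k_adPow, ad_k_adPow, ← sub_smul, smul_smul]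
    have h0 : D.ad (D.f i) (D.adPow i j 0) = 0 := by simpa [adPow] using D.ad_f_e_of_ne hij
    rw [h0, map_zero, zero_sub, ← neg_smul]
    exact ⟨_, rfl⟩
  | succ n ih =>
    obtain ⟨s, hs⟩ := ih
    rw [step, ad_k_adPow, ad_k_adPow, ← sub_smul, smul_smul, hs, map_smul, ← adPow_succ, ← sub_smul]
    exact ⟨_, rfl⟩

lemma ad_f_pow_adPow {i j : I} (hij : j ≠ i) (n : ℕ) :
    (D.ad (D.f i) ^ (n + 1)) (D.adPow i j n) = 0 := by
  induction n with
  | zero => simpa [adPow] using D.ad_f_e_of_ne hij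
  | succ n ih =>
    obtain ⟨s, hs⟩ := D.ad_f_adPow hij n
    rw [pow_succ, Module.End.mul_apply, hs, map_smul, ih, smul_zero]

lemma ad_e_pow_adPow {i j : I} (hij : j ≠ i) (n : ℕ) :
    (D.ad (D.e i) ^ (1 - D.c i j).toNat) (D.adPow i j n) = 0 := by
  rw [adPow, ← Module.End.mul_apply, ← pow_add, add_comm, pow_add, Module.End.mul_apply, ← adPow,
    adPow_eq_zero D hij.symm, map_zero]

/-! ### Stability of `U⁺[i]` -/

lemma adPow_mem {i j : I} (hij : j ≠ i) (n : ℕ) : D.adPow i j n ∈ D.UPlusSub i := by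
  have h1 : divPow (C.q i) n (D.ad (D.e i)) (D.e j) ∈ D.UPlusSub i :=
    Algebra.subset_adjoin ⟨j, n, hij, rfl⟩
  rw [divPow, LinearMap.smul_apply] at h1
  have := (D.UPlusSub i).smul_mem h1 (qFact (C.q i) n)
  rwa [smul_smul, mul_inv_cancel₀ (qFact_ne_zero (C.q_ne_zero i) (C.q_generic i) n), one_smul]
    at this

lemma uPlusSub_eq (i : I) :
    D.UPlusSub i = Algebra.adjoin K {y | ∃ (j : I) (n : ℕ), j ≠ i ∧ y = D.adPow i j n} := by
  refine le_antisymm (Algebra.adjoin_le ?_) (Algebra.adjoin_le ?_)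
  · rintro _ ⟨j, n, hij, rfl⟩
    rw [divPow, LinearMap.smul_apply]
    refine Subalgebra.smul_mem _ (Algebra.subset_adjoin ?_) _
    exact ⟨j, n, hij, rfl⟩
  · rintro _ ⟨j, n, hij, rfl⟩
    exact D.adPow_mem hij n

/-- Induction principle for `U⁺[i]`. -/
lemma uPlusSub_induction {i : I} {p : D.U → Prop}
    (adPow : ∀ j n, j ≠ i → p (D.adPow i j n)) (one : p 1) (smul : ∀ (r : K) x, p x → p (r • x))
    (add : ∀ x y, p x → p y → p (x + y))
    (mul : ∀ x y, x ∈ D.UPlusSub i → y ∈ D.UPlusSub i → p x → p y → p (x * y))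
    {x : D.U} (hx : x ∈ D.UPlusSub i) : p x := by
  rw [uPlusSub_eq] at hx mul
  induction hx using Algebra.adjoin_induction with
  | mem x hx =>
    obtain ⟨j, n, hij, rfl⟩ := hx
    exact adPow j n hij
  | algebraMap r =>
    rw [Algebra.algebraMap_eq_smul_one]
    exact smul r 1 one
  | add x y _ _ hx hy => exact add x y hx hy
  | mul x y hx' hy' hx hy => exact mul x y hx' hy' hx hy

lemma ad_k_mem (μ : Y) {i : I} {x : D.U} (hx : x ∈ D.UPlusSub i) :
    D.ad (D.k μ) x ∈ D.UPlusSub i := by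
  refine D.uPlusSub_induction (p := fun x => D.ad (D.k μ) x ∈ D.UPlusSub i) ?_ ?_ ?_ ?_ ?_ hx
  · intro j n hij
    rw [ad_k_adPow]
    exact Subalgebra.smul_mem _ (D.adPow_mem hij n) _
  · rw [ad_k_one]
    exact one_mem _
  · intro r x hx
    rw [map_smul]
    exact Subalgebra.smul_mem _ hx _
  · intro x y hx hy
    rw [map_add]
    exact add_mem hx hy
  · intro x y _ _ hx hy
    rw [ad_k_mul]
    exact mul_mem hx hy

lemma ad_e_mem {i : I} {x : D.U} (hx : x ∈ D.UPlusSub i) : D.ad (D.e i) x ∈ D.UPlusSub i := by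
  refine D.uPlusSub_induction (p := fun x => D.ad (D.e i) x ∈ D.UPlusSub i) ?_ ?_ ?_ ?_ ?_ hx
  · intro j n hij
    rw [← adPow_succ]
    exact D.adPow_mem hij _
  · rw [ad_e_one]
    exact zero_mem _
  · intro r x hx
    rw [map_smul]
    exact Subalgebra.smul_mem _ hx _
  · intro x y hx hy
    rw [map_add]
    exact add_mem hx hy
  · intro x y hx' hy' hx hy
    rw [ad_e_mul]
    exact add_mem (mul_mem hx hy') (mul_mem (D.ad_k_mem _ hx') hy)

lemma ad_f_mem {i : I} {x : D.U} (hx : x ∈ D.UPlusSub i) : D.ad (D.f i) x ∈ D.UPlusSub i := by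
  refine D.uPlusSub_induction (p := fun x => D.ad (D.f i) x ∈ D.UPlusSub i) ?_ ?_ ?_ ?_ ?_ hx
  · intro j n hij
    cases n with
    | zero =>
      have h0 : D.ad (D.f i) (D.adPow i j 0) = 0 := by simpa [adPow] using D.ad_f_e_of_ne hij
      rw [h0]
      exact zero_mem _
    | succ n =>
      obtain ⟨s, hs⟩ := D.ad_f_adPow hij n
      rw [hs]
      exact Subalgebra.smul_mem _ (D.adPow_mem hij _) _
  · rw [ad_f_one]
    exact zero_mem _
  · intro r x hx
    rw [map_smul]
    exact Subalgebra.smul_mem _ hx _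
  · intro x y hx hy
    rw [map_add]
    exact add_mem hx hy
  · intro x y hx' hy' hx hy
    rw [ad_f_mul]
    exact add_mem (mul_mem hx (D.ad_k_mem _ hy')) (mul_mem hx' hy)

lemma isAdStable_uPlusSub (i : I) : D.IsAdStable i (Subalgebra.toSubmodule (D.UPlusSub i)) := by
  intro z hz
  induction hz using Algebra.adjoin_induction with
  | mem x hx =>
    intro y hy
    rcases hx with rfl | rfl | rfl
    · exact D.ad_e_mem hy
    · exact D.ad_f_mem hy
    · exact D.ad_k_mem _ hy
  | algebraMap r =>
    intro y hy
    rw [AlgHom.commutes, Module.algebraMap_end_apply]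
    exact Submodule.smul_mem _ _ hy
  | add a b _ _ ha hb =>
    intro y hy
    rw [map_add, LinearMap.add_apply]
    exact add_mem (ha y hy) (hb y hy)
  | mul a b _ _ ha hb =>
    intro y hy
    rw [map_mul, Module.End.mul_apply]
    exact ha _ (hb y hy)

lemma e_mem (j : I) : D.e j ∈ D.UPlus := Algebra.subset_adjoin ⟨j, rfl⟩

/-- The torus only rescales string elements, so `ad_{e_i}` acts on them as a `q`-commutator with
`e_i`, which stays in `U⁺`. -/
lemma uPlusSub_le (i : I) : D.UPlusSub i ≤ D.UPlus := by
  rw [uPlusSub_eq]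
  refine Algebra.adjoin_le ?_
  rintro _ ⟨j, n, -, rfl⟩
  induction n with
  | zero => exact D.e_mem j
  | succ n ih =>
    rw [SetLike.mem_coe, adPow_succ, ad_e_apply, ← ad_k_apply, ad_k_adPow]
    exact sub_mem (mul_mem (D.e_mem i) ih) (mul_mem (Subalgebra.smul_mem _ ih _) (D.e_mem i))

end RootDatum

/-! ### Integrability of `U⁺[i]` -/

/-- Local nilpotency of a skew derivation is inherited by products. -/
lemma skewDerivation_pow_mul {A : Type*} [Ring A] [Algebra K A] {E G H : Module.End K A} {s t : K}
    (hE : ∀ x y, E (x * y) = E x * G y + H x * E y) (hG : E * G = s • (G * E))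
    (hH : E * H = t • (H * E)) (N : ℕ) {m n : ℕ} (hN : m + n = N) {x y : A}
    (hx : (E ^ m) x = 0) (hy : (E ^ n) y = 0) : (E ^ N) (x * y) = 0 := by
  have comm : ∀ {L : Module.End K A} {r : K}, E * L = r • (L * E) →
      ∀ (n : ℕ) (z : A), (E ^ n) z = 0 → (E ^ n) (L z) = 0 := by
    intro L r h n z hz
    have : E ^ n * L = r ^ n • (L * E ^ n) := by
      clear hz
      induction n with
      | zero => simp
      | succ n ih =>
        rw [pow_succ, mul_assoc, h, mul_smul_comm, ← mul_assoc, ih, smul_mul_assoc, smul_smul,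
          mul_assoc, ← pow_succ, ← pow_succ']
    rw [← Module.End.mul_apply, this, LinearMap.smul_apply, Module.End.mul_apply, hz, map_zero,
      smul_zero]
  induction N generalizing m n x y with
  | zero =>
    obtain ⟨rfl, rfl⟩ : m = 0 ∧ n = 0 := by omega
    simp only [pow_zero, Module.End.one_apply] at hx
    simp [hx]
  | succ N ih =>
    cases m with
    | zero =>
      simp only [pow_zero, Module.End.one_apply] at hx
      simp [hx]
    | succ m =>
      cases n with
      | zero =>
        simp only [pow_zero, Module.End.one_apply] at hy
        simp [hy]
      | succ n =>
        -- One application of `E` gives `E x * G y + H x * E y`. In each term one factor needs one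
        -- power less, and `G`, `H` preserve the kernels of powers of `E`, so the total exponent
        -- drops by one.
        rw [pow_succ, Module.End.mul_apply, hE, map_add]
        rw [ih (m := m) (n := n + 1) (by omega)
          (by rwa [pow_succ, Module.End.mul_apply] at hx) (comm hG _ _ hy),
          ih (m := m + 1) (n := n) (by omega) (comm hH _ _ hx)
          (by rwa [pow_succ, Module.End.mul_apply] at hy), add_zero]

lemma exists_pow_apply_add {V : Type*} [AddCommGroup V] [Module K V] {E : Module.End K V} {x y : V}
    (hx : ∃ n : ℕ, (E ^ n) x = 0) (hy : ∃ n : ℕ, (E ^ n) y = 0) :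
    ∃ n : ℕ, (E ^ n) (x + y) = 0 := by
  obtain ⟨m, hm⟩ := hx
  obtain ⟨n, hn⟩ := hy
  refine ⟨m + n, ?_⟩
  rw [map_add, Module.End.pow_map_zero_of_le (by omega) hm,
    Module.End.pow_map_zero_of_le (by omega) hn, add_zero]

namespace RootDatum

variable (D : RootDatum C X Y)

lemma exists_ad_e_pow {i : I} {x : D.U} (hx : x ∈ D.UPlusSub i) :
    ∃ n : ℕ, (D.ad (D.e i) ^ n) x = 0 := by
  refine D.uPlusSub_induction (p := fun x => ∃ n : ℕ, (D.ad (D.e i) ^ n) x = 0) ?_ ?_ ?_ ?_ ?_ hx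
  · intro j n hij
    exact ⟨_, D.ad_e_pow_adPow hij n⟩
  · exact ⟨1, by rw [pow_one, ad_e_one]⟩
  · rintro r x ⟨n, hn⟩
    exact ⟨n, by rw [map_smul, hn, smul_zero]⟩
  · intro x y hx hy
    exact exists_pow_apply_add hx hy
  · rintro x y - - ⟨m, hm⟩ ⟨n, hn⟩
    refine ⟨m + n, skewDerivation_pow_mul (G := 1) (H := D.ad (D.k (D.h i))) (s := 1)
      (t := q ^ (-D.pairing (D.h i) (D.root i))) (fun x y => D.ad_e_mul i x y) (by simp) ?_ _ rfl hm hn⟩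
    rw [← map_mul, e_mul_k, map_smul, map_mul]

lemma exists_ad_f_pow {i : I} {x : D.U} (hx : x ∈ D.UPlusSub i) :
    ∃ n : ℕ, (D.ad (D.f i) ^ n) x = 0 := by
  refine D.uPlusSub_induction (p := fun x => ∃ n : ℕ, (D.ad (D.f i) ^ n) x = 0) ?_ ?_ ?_ ?_ ?_ hx
  · intro j n hij
    exact ⟨_, D.ad_f_pow_adPow hij n⟩
  · exact ⟨1, by rw [pow_one, ad_f_one]⟩
  · rintro r x ⟨n, hn⟩
    exact ⟨n, by rw [map_smul, hn, smul_zero]⟩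
  · intro x y hx hy
    exact exists_pow_apply_add hx hy
  · rintro x y - - ⟨m, hm⟩ ⟨n, hn⟩
    refine ⟨m + n, skewDerivation_pow_mul (G := D.ad (D.k (-D.h i))) (H := 1) (t := 1)
      (s := q ^ D.pairing (-D.h i) (D.root i)) (fun x y => D.ad_f_mul i x y) ?_ (by simp) _ rfl hm hn⟩
    rw [← map_mul, f_mul_k, map_smul, map_mul]

lemma coe_adRep {i : I} {V : Submodule K D.U} (hV : D.IsAdStable i V) (z : D.USub i) (y : V) :
    (D.adRep i V hV z y : D.U) = D.ad z y := rfl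

lemma coe_adRep_pow {i : I} {V : Submodule K D.U} (hV : D.IsAdStable i V) (z : D.USub i) (n : ℕ)
    (y : V) : ((D.adRep i V hV z ^ n) y : D.U) = (D.ad z ^ n) y := by
  rw [← map_pow, coe_adRep, Subalgebra.coe_pow, map_pow]

lemma q_zpow_injective (C : CartanDatum I) (i : I) :
    Function.Injective fun n : ℤ => C.q i ^ n := by
  have key : ∀ m n : ℤ, m < n → C.q i ^ m ≠ C.q i ^ n := by
    intro m n hmn h
    apply C.q_generic i (n - m) (by omega)
    rw [zpow_sub₀ (C.q_ne_zero i), h, div_self (zpow_ne_zero _ (C.q_ne_zero i))]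
  intro m n h
  rcases lt_trichotomy m n with hmn | rfl | hmn
  · exact absurd h (key m n hmn)
  · rfl
  · exact absurd h.symm (key n m hmn)

/-- Products of string elements span `U⁺[i]`, and each is a weight vector because conjugation by
`k_i` is multiplicative. -/
lemma mem_iSup_weightSpace {i : I} (hst : D.IsAdStable i (Subalgebra.toSubmodule (D.UPlusSub i)))
    {x : D.U} (hx : x ∈ D.UPlusSub i) :
    (⟨x, hx⟩ : Subalgebra.toSubmodule (D.UPlusSub i)) ∈
      ⨆ n, D.weightSpace i (D.adRep i _ hst) n := by
  have hx' := hx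
  rw [uPlusSub_eq, ← Subalgebra.mem_toSubmodule, Algebra.adjoin_eq_span] at hx'
  have key : ∀ y ∈ Submonoid.closure {y | ∃ (j : I) (n : ℕ), j ≠ i ∧ y = D.adPow i j n},
      y ∈ D.UPlusSub i ∧ ∃ n : ℤ, D.ad (D.k (D.h i)) y = C.q i ^ n • y := by
    intro y hy
    induction hy using Submonoid.closure_induction with
    | mem y hy =>
      obtain ⟨j, n, hij, rfl⟩ := hy
      refine ⟨D.adPow_mem hij n, D.c i j + 2 * n, ?_⟩
      rw [ad_k_adPow, pairing_h, pairing_h, CartanDatum.q, ← zpow_mul, mul_add, d_mul_c,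
        ← C.two_d i]
      congr 2
      ring
    | one => exact ⟨one_mem _, 0, by rw [ad_k_one, zpow_zero, one_smul]⟩
    | mul x y _ _ hx hy =>
      obtain ⟨hx, m, hm⟩ := hx
      obtain ⟨hy, n, hn⟩ := hy
      refine ⟨mul_mem hx hy, m + n, ?_⟩
      rw [ad_k_mul, hm, hn, smul_mul_smul_comm, zpow_add₀ (C.q_ne_zero i)]
  -- Membership in `U⁺[i]` is carried along as part of the claim, since the element of the subtype
  -- depends on its proof.
  suffices h : ∃ hx : x ∈ D.UPlusSub i,
      (⟨x, hx⟩ : Subalgebra.toSubmodule (D.UPlusSub i)) ∈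
        ⨆ n, D.weightSpace i (D.adRep i _ hst) n from h.2
  clear hx
  induction hx' using Submodule.span_induction with
  | mem y hy =>
    obtain ⟨hy, n, hn⟩ := key y hy
    refine ⟨hy, Submodule.mem_iSup_of_mem n ?_⟩
    rw [weightSpace, Module.End.mem_eigenspace_iff]
    exact Subtype.ext hn
  | zero => exact ⟨zero_mem _, zero_mem _⟩
  | add x y _ _ hx hy => exact ⟨add_mem hx.1 hy.1, add_mem hx.2 hy.2⟩
  | smul r x _ hx => exact ⟨Subalgebra.smul_mem _ hx.1 r, Submodule.smul_mem _ r hx.2⟩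

lemma isIntegrable_uPlusSub {i : I}
    (hst : D.IsAdStable i (Subalgebra.toSubmodule (D.UPlusSub i))) :
    D.IsIntegrable i (D.adRep i _ hst) := by
  constructor
  · rw [DirectSum.isInternal_submodule_iff_iSupIndep_and_iSup_eq_top]
    constructor
    · exact (Module.End.eigenspaces_iSupIndep _).comp (q_zpow_injective C i)
    · rw [eq_top_iff]
      rintro ⟨x, hx⟩ -
      exact D.mem_iSup_weightSpace hst hx
  · rintro ⟨x, hx⟩
    obtain ⟨m, hm⟩ := D.exists_ad_e_pow hx
    obtain ⟨n, hn⟩ := D.exists_ad_f_pow hx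
    refine ⟨m + n, Subtype.ext ?_, Subtype.ext ?_⟩
    · rw [coe_adRep_pow]
      exact Module.End.pow_map_zero_of_le (by omega) hm
    · rw [coe_adRep_pow]
      exact Module.End.pow_map_zero_of_le (by omega) hn

/-! ### Maximality of `U⁺[i]` -/

/-- The span of the products `p e_i^n` with `p ∈ U⁺[i]` contains `1`, and it is stable under left
multiplication by every `e_j`. For `j = i` this is `e_i p = ad_{e_i}(p) + ad_{k_i}(p) e_i`; for `j ≠
i` the generator `e_j` is absorbed into `p`. -/
lemma exists_eq_sum_mul_pow {i : I} {x : D.U} (hx : x ∈ D.UPlus) :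
    ∃ (N : ℕ) (y : ℕ → D.U), (∀ n, y n ∈ D.UPlusSub i) ∧
      x = ∑ n ∈ Finset.range N, y n * D.e i ^ n := by
  set W : Submodule K D.U := Submodule.span K {z | ∃ p ∈ D.UPlusSub i, ∃ n : ℕ, z = p * D.e i ^ n}
  have hgen : ∀ p ∈ D.UPlusSub i, ∀ n : ℕ, p * D.e i ^ n ∈ W := fun p hp n =>
    Submodule.subset_span ⟨p, hp, n, rfl⟩
  have hleft : ∀ u ∈ D.UPlus, ∀ w ∈ W, u * w ∈ W := by
    intro u hu
    induction hu using Algebra.adjoin_induction with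
    | mem u hu =>
      obtain ⟨j, rfl⟩ := hu
      intro w hw
      induction hw using Submodule.span_induction with
      | mem w hw =>
        obtain ⟨p, hp, n, rfl⟩ := hw
        by_cases hij : j = i
        · subst hij
          have : D.e j * (p * D.e j ^ n) = D.ad (D.e j) p * D.e j ^ n
              + D.ad (D.k (D.h j)) p * D.e j ^ (n + 1) := by
            rw [ad_e_apply, ← ad_k_apply, pow_succ', sub_mul]
            simp only [mul_assoc]
            abel
          rw [this]
          exact add_mem (hgen _ (D.ad_e_mem hp) _) (hgen _ (D.ad_k_mem _ hp) _)
        · rw [← mul_assoc]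
          exact hgen _ (mul_mem (D.adPow_mem hij 0) hp) _
      | zero => rw [mul_zero]; exact zero_mem _
      | add a b _ _ ha hb => rw [mul_add]; exact add_mem ha hb
      | smul r a _ ha => rw [mul_smul_comm]; exact Submodule.smul_mem _ _ ha
    | algebraMap r =>
      intro w hw
      rw [← Algebra.smul_def]
      exact Submodule.smul_mem _ _ hw
    | add a b _ _ ha hb => intro w hw; rw [add_mul]; exact add_mem (ha w hw) (hb w hw)
    | mul a b _ _ ha hb => intro w hw; rw [mul_assoc]; exact ha _ (hb w hw)
  have hxW : x ∈ W := by
    have := hleft x hx _ (hgen 1 (one_mem _) 0)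
    rwa [pow_zero, mul_one, mul_one] at this
  have hfin : ∃ y : ℕ →₀ D.U, (∀ n, y n ∈ D.UPlusSub i) ∧ x = y.sum fun n a => a * D.e i ^ n := by
    clear hx
    induction hxW using Submodule.span_induction with
    | mem w hw =>
      obtain ⟨p, hp, n, rfl⟩ := hw
      refine ⟨Finsupp.single n p, fun m => ?_, ?_⟩
      · classical
        rw [Finsupp.single_apply]
        split_ifs
        · exact hp
        · exact zero_mem _
      · rw [Finsupp.sum_single_index (zero_mul _)]
    | zero => exact ⟨0, fun _ => zero_mem _, Finsupp.sum_zero_index.symm⟩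
    | add a b _ _ ha hb =>
      obtain ⟨y, hy, rfl⟩ := ha
      obtain ⟨z, hz, rfl⟩ := hb
      exact ⟨y + z, fun n => add_mem (hy n) (hz n),
        (Finsupp.sum_add_index' (fun _ => zero_mul _) fun _ _ _ => add_mul _ _ _).symm⟩
    | smul r a _ ha =>
      obtain ⟨y, hy, rfl⟩ := ha
      refine ⟨r • y, fun n => Subalgebra.smul_mem _ (hy n) r, ?_⟩
      rw [Finsupp.sum_smul_index' fun _ => zero_mul _, Finsupp.smul_sum]
      simp only [smul_mul_assoc]
  obtain ⟨y, hy, rfl⟩ := hfin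
  refine ⟨y.support.sup id + 1, y, hy, Finsupp.sum_of_support_subset _ ?_ _ fun _ _ => zero_mul _⟩
  intro n hn
  rw [Finset.mem_range, Nat.lt_succ_iff]
  exact Finset.le_sup (f := id) hn

/-- The scalar by which `k_i²` enters `ad_{f_i} (e_i^{n+1})`. -/
noncomputable def lowerCoeff (C : CartanDatum I) (i : I) (n : ℕ) : K :=
  (C.q i - (C.q i)⁻¹)⁻¹ * ∑ l ∈ Finset.range (n + 1), (q ^ C.dot i i) ^ l

/-- The geometric sum times `q^(i·i) - 1` is `q^((n+1) i·i) - 1`, which is nonzero because `q` is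
not a root of unity. -/
lemma lowerCoeff_ne_zero (C : CartanDatum I) (i : I) (n : ℕ) : lowerCoeff C i n ≠ 0 := by
  refine mul_ne_zero (inv_ne_zero ?_) fun h => ?_
  · intro h
    apply C.q_generic i 2 two_pos
    rw [zpow_two]
    nth_rewrite 2 [sub_eq_zero.1 h]
    exact mul_inv_cancel₀ (C.q_ne_zero i)
  · have h1 := geom_sum_mul (q ^ C.dot i i) (n + 1)
    rw [h, zero_mul, eq_comm, sub_eq_zero, ← zpow_natCast, ← zpow_mul] at h1
    exact q_zpow_ne_one (mul_pos (C.dot_self_pos i) (by positivity)) h1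

/-- Induction with the skew Leibniz rule, starting from `ad_{f_i}(e_i) = (1 - k_i²) / (q_i -
q_i⁻¹)`. Only the coefficient of `e_i^n k_i²` matters later, as the other term lies in `U⁺`. -/
lemma ad_f_pow_succ (i : I) (n : ℕ) : ∃ a : K, D.ad (D.f i) (D.e i ^ (n + 1))
    = a • D.e i ^ n - lowerCoeff C i n • (D.e i ^ n * D.k (D.h i + D.h i)) := by
  have h1 : D.ad (D.f i) (D.e i) = (C.q i - (C.q i)⁻¹)⁻¹ • (1 - D.k (D.h i + D.h i)) := by
    rw [ad_f_apply, ← neg_sub, e_f_same, ← smul_neg, neg_sub, smul_mul_assoc, sub_mul, k_neg_mul_k,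
      k_mul_k]
  induction n with
  | zero =>
    refine ⟨(C.q i - (C.q i)⁻¹)⁻¹, ?_⟩
    simp [h1, lowerCoeff, smul_sub]
  | succ n ih =>
    obtain ⟨a, ha⟩ := ih
    refine ⟨(C.q i - (C.q i)⁻¹)⁻¹ * q ^ (((n + 1 : ℕ) : ℤ) * -C.dot i i) + a, ?_⟩
    have h2 : lowerCoeff C i (n + 1)
        = (C.q i - (C.q i)⁻¹)⁻¹ * (q ^ C.dot i i) ^ (n + 1) + lowerCoeff C i n := by
      rw [lowerCoeff, Finset.sum_range_succ, mul_add, add_comm, lowerCoeff]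
    -- Moving `k_i²` past `e_i^(n+1)` gives `q^(2(n+1) i·i)`, and the twist by `ad_{k_i⁻¹}` gives
    -- `q^(-(n+1) i·i)`; the product is the next term of the geometric sum.
    have h3 : (q ^ C.dot i i) ^ (n + 1)
        = q ^ (((n + 1 : ℕ) : ℤ) * -C.dot i i) * q ^ (((n + 1 : ℕ) : ℤ) * (C.dot i i + C.dot i i)) := by
      rw [← zpow_natCast, ← zpow_mul, ← zpow_add₀ q_ne_zero]
      congr 1
      ring
    rw [pow_succ' (D.e i) (n + 1), ad_f_mul, ha, h1, ad_k_pow, map_neg, LinearMap.neg_apply,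
      pairing_h, smul_mul_smul_comm, sub_mul, one_mul, k_mul_pow, map_add, LinearMap.add_apply,
      pairing_h, h2, h3, mul_sub, mul_smul_comm, mul_smul_comm, ← mul_assoc, ← pow_succ', smul_sub,
      smul_smul, add_smul, add_smul, mul_assoc]
    abel

/-- After applying `ad_{f_i}`, everything except the `k_i²` parts visibly lies in `U⁺`. Hence this
sum and its product with `k_i²` both lie in `U⁺`, and `eq_zero_of_mul_k_mem` applies. The index
shifts because `ad_{f_i}` lowers the power of `e_i` by one and kills `1`. -/
lemma sum_eq_zero_of_ad_f_mem {i : I} (N : ℕ) {y : ℕ → D.U} (hy : ∀ n, y n ∈ D.UPlusSub i)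
    (h : D.ad (D.f i) (∑ n ∈ Finset.range (N + 1), y n * D.e i ^ n) ∈ D.UPlus) :
    ∑ n ∈ Finset.range N, (lowerCoeff C i n • y (n + 1)) * D.e i ^ n = 0 := by
  choose a ha using D.ad_f_pow_succ i
  have hP : ∀ {z}, z ∈ D.UPlusSub i → z ∈ D.UPlus := fun hz => D.uPlusSub_le i hz
  have he : ∀ n, D.e i ^ n ∈ D.UPlus := fun n => pow_mem (D.e_mem i) n
  refine D.eq_zero_of_mul_k_mem i
    (sum_mem fun n _ => mul_mem (Subalgebra.smul_mem _ (hP (hy _)) _) (he n)) ?_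
  have key : (∑ n ∈ Finset.range N, (lowerCoeff C i n • y (n + 1)) * D.e i ^ n)
        * D.k (D.h i + D.h i)
      = ∑ n ∈ Finset.range (N + 1), D.ad (D.f i) (y n) * D.ad (D.k (-D.h i)) (D.e i ^ n)
        + ∑ n ∈ Finset.range N, a n • (y (n + 1) * D.e i ^ n)
        - D.ad (D.f i) (∑ n ∈ Finset.range (N + 1), y n * D.e i ^ n) := by
    have h1 : D.ad (D.f i) (∑ n ∈ Finset.range (N + 1), y n * D.e i ^ n)
        = ∑ n ∈ Finset.range (N + 1), D.ad (D.f i) (y n) * D.ad (D.k (-D.h i)) (D.e i ^ n)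
          + ∑ n ∈ Finset.range N, y (n + 1) * D.ad (D.f i) (D.e i ^ (n + 1)) := by
      rw [map_sum]
      simp only [ad_f_mul]
      rw [Finset.sum_add_distrib, Finset.sum_range_succ' fun n => y n * D.ad (D.f i) (D.e i ^ n),
        pow_zero, ad_f_one, mul_zero, add_zero]
    rw [h1, add_sub_add_left_eq_sub, ← Finset.sum_sub_distrib, Finset.sum_mul]
    refine Finset.sum_congr rfl fun n _ => ?_
    rw [ha, mul_sub, mul_smul_comm, mul_smul_comm, sub_sub_cancel, smul_mul_assoc, smul_mul_assoc,
      mul_assoc]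
  rw [key]
  refine sub_mem (add_mem (sum_mem fun n _ => mul_mem (hP (D.ad_f_mem (hy n))) ?_)
    (sum_mem fun n _ => Subalgebra.smul_mem _ (mul_mem (hP (hy _)) (he n)) _)) h
  rw [ad_k_pow]
  exact Subalgebra.smul_mem _ (he n) _

/-- Freeness over `U⁺[i]`: applying `ad_{f_i}` turns a relation into a shorter one whose
coefficients are nonzero multiples of `y_{n+1}`. Induction kills these, and then `y_0` is the only
remaining term. -/
lemma eq_zero_of_sum_mul_pow_eq_zero {i : I} (N : ℕ) {y : ℕ → D.U}
    (hy : ∀ n, y n ∈ D.UPlusSub i) (h : ∑ n ∈ Finset.range N, y n * D.e i ^ n = 0) :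
    ∀ n < N, y n = 0 := by
  induction N generalizing y with
  | zero => intro n hn; omega
  | succ N ih =>
    have h1 := D.sum_eq_zero_of_ad_f_mem N hy (by rw [h, map_zero]; exact zero_mem _)
    have h2 : ∀ n < N, y (n + 1) = 0 := fun n hn =>
      (smul_eq_zero_iff_right (lowerCoeff_ne_zero C i n)).1
        (ih (fun n => Subalgebra.smul_mem _ (hy _) _) h1 n hn)
    rw [Finset.sum_range_succ', Finset.sum_eq_zero, pow_zero, mul_one, zero_add] at h
    · intro n hn
      cases n with
      | zero => exact h
      | succ n => exact h2 n (by omega)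
    · intro n hn
      rw [h2 n (Finset.mem_range.1 hn), zero_mul]

lemma mem_uPlusSub_of_ad_f_mem {i : I} {x : D.U} (hx : x ∈ D.UPlus)
    (h : D.ad (D.f i) x ∈ D.UPlus) : x ∈ D.UPlusSub i := by
  obtain ⟨N, y, hy, rfl⟩ := D.exists_eq_sum_mul_pow (i := i) hx
  cases N with
  | zero => exact zero_mem _
  | succ N =>
    have h1 := D.eq_zero_of_sum_mul_pow_eq_zero N (fun n => Subalgebra.smul_mem _ (hy (n + 1)) _)
      (D.sum_eq_zero_of_ad_f_mem N hy h)
    rw [Finset.sum_range_succ', Finset.sum_eq_zero, pow_zero, mul_one, zero_add]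
    · exact hy 0
    · intro n hn
      rw [(smul_eq_zero_iff_right (lowerCoeff_ne_zero C i n)).1 (h1 n (Finset.mem_range.1 hn)),
        zero_mul]

end RootDatum
end QuantumAdjoint

theorem mainTheorem10 {I X Y : Type*} [AddCommGroup X] [AddCommGroup Y]
    {C : QuantumAdjoint.CartanDatum I} (D : QuantumAdjoint.RootDatum C X Y) (i : I) :
    D.UPlusSub i ≤ D.UPlus ∧
    (∃ hst : D.IsAdStable i (Subalgebra.toSubmodule (D.UPlusSub i)),
      D.IsIntegrable i (D.adRep i (Subalgebra.toSubmodule (D.UPlusSub i)) hst)) ∧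
    ∀ (V : Submodule QuantumAdjoint.K D.U) (hV : D.IsAdStable i V),
      V ≤ Subalgebra.toSubmodule D.UPlus → D.IsIntegrable i (D.adRep i V hV) →
        V ≤ Subalgebra.toSubmodule (D.UPlusSub i) := by
  refine ⟨D.uPlusSub_le i, ⟨D.isAdStable_uPlusSub i, D.isIntegrable_uPlusSub _⟩, ?_⟩
  intro V hV hVU _ x hx
  -- Both `x` and `ad_{f_i} x` lie in `V`, hence in `U⁺`.
  exact D.mem_uPlusSub_of_ad_f_mem (hVU hx)
    (hVU (hV _ (Algebra.subset_adjoin (by simp)) x hx))
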